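/- Let $\mathbb G$ be a Carnot group, i.e. a connected, simply connected, nilpotent Lie group whose Lie algebra has a stratification $\mathfrak g=\mathfrak g_1\oplus\dots\oplus\mathfrak g_s$ with $\mathfrak g_{j+1}=[\mathfrak g_j,\mathfrak g_1]$ for $1\le j<s$, $\mathfrak g_s\ne\{0\}$ and $[\mathfrak g_s,\mathfrak g]=\{0\}$. Identify $\mathbb G$ with $\mathbb R^n$ by exponential coordinates, and let $X_1,\dots,X_m$ be a basis of $\mathfrak g_1$, regarded as left-invariant vector fields on $\mathbb R^n$. The product $\mathbb G\times\mathbb R\equiv\mathbb R^{n+1}$ is the Carnot group whose Lie algebra $\mathfrak g\times\mathbb R$ has the stratification $(\mathfrak g_1\times\mathbb R)\oplus(\mathfrak g_2\times\{0\})\oplus\dots\oplus(\mathfrak g_s\times\{0\})$; let $Y_1,\dots,Y_{m+1}$ be a basis of its first layer $\mathfrak g_1\times\mathbb R$, regarded as left-invariant vector fields on $\mathbb R^{n+1}$. For a tuple $Z=(Z_1,\dots,Z_k)$ of smooth vector fields $Z_i=\sum_j a_{ij}\partial_{x_j}$ on $\mathbb R^N$, an open set $U\subset\mathbb R^N$ and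 $v\in L^1_{loc}(U)$, say that $D_Zv$ is a finite measure on $U$ if there is an $\mathbb R^k$-valued Borel measure $D_Zv=(D_{Z_1}v,\dots,D_{Z_k}v)$ of finite total variation on $U$ such that $$\sum_{i=1}^k\int_U\varphi_i\,d(D_{Z_i}v)=-\int_U v\,\sum_{i=1}^k\sum_{j=1}^N\partial_{x_j}(a_{ij}\varphi_i)\,d\mathscr L^N\qquad\text{for all }\varphi\in C^1_c(U;\mathbb R^k).$$ For an open set $\Omega\subset\mathbb G$, $BV_H(\Omega)$ is the set of $u\in L^1(\Omega)$ such that $D_Xu$ is a finite measure on $\Omega$. A set $E\subset\Omega\times\mathbb R$ has finite $H$-perimeter in $\Omega\times\mathbb R$ if $\chi_E\in L^1_{loc}(\Omega\times\mathbb R)$ and $D_Y\chi_E$ is a finite measure on $\Omega\times\mathbb R$. **Theorem.** Suppose that $\Omega\subset\mathbb G$ is open and bounded, and let $u\in L^1(\Omega)$. Then $u$ belongs to $BV_H(\Omega)$ if and only if its subgraph $E_u:=\{(x,t)\in\Omega\times\mathbb R:t<u(x)\}$ has finite $H$-perimeter in $\Omega\times\mathbb R$. -/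

import Mathlib

open MeasureTheory
open scoped ContDiff

noncomputable section

/-! ### Carnot groups in exponential coordinates -/

section LieAlgebra

variable {E : Type*} [NormedAddCommGroup E] [NormedSpace ℝ E]

/-- The left-invariant vector field on `E`, for the group law `mul` with identity `0`, whose value
at the identity is `v`: at `x` it is the image of `v` under the differential at `0` of the left
translation `y ↦ mul x y`. -/
def leftInvariantField (mul : E → E → E) (v : E) (x : E) : E :=
  fderiv ℝ (mul x) 0 v

/-- The bracket of the Lie algebra of the group law `mul` with identity `0`. The Lie algebra is the
tangent space `E` at `0`, and the bracket of `v` and `w` is the value at `0` of the Lie bracket of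
the left-invariant vector fields extending `v` and `w`. -/
def groupBracket (mul : E → E → E) (v w : E) : E :=
  VectorField.lieBracket ℝ (leftInvariantField mul v) (leftInvariantField mul w) 0

/-- If left translations are smooth, jointly in both factors, then so are the left-invariant
vector fields. -/
lemma contDiff_leftInvariantField {mul : E → E → E}
    (h : ContDiff ℝ ∞ (fun p : E × E => mul p.1 p.2)) (v : E) :
    ContDiff ℝ ∞ (leftInvariantField mul v) := by
  have h1 : ContDiff ℝ ∞ (fun x : E => fderiv ℝ (mul x) 0) :=
    ContDiff.fderiv (f := mul) (g := fun _ : E => (0 : E)) (n := ∞) (m := ∞) h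
      contDiff_const (by simp)
  exact h1.clm_apply contDiff_const

end LieAlgebra

/-- A Carnot group, i.e. a connected, simply connected, nilpotent Lie group whose Lie algebra is
stratified, written in exponential coordinates.

The underlying manifold is a finite-dimensional vector space `E` (hence connected and simply
connected) with a smooth associative product `mul`. The law `smul_mul_smul` says that each line
`t ↦ t • x` is a one-parameter subgroup; since its velocity at time `0` is `x`, this means that the
exponential map from the Lie algebra `T₀E = E` to the group `E` is the identity map. It also
contains that `0` is the identity and that `-x` is the inverse of `x`.

The Lie algebra is stratified by `layer 1, …, layer step` (the other values of `layer` play no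
role); in particular it is nilpotent, and so is the group. -/
structure CarnotGroup (E : Type*) [NormedAddCommGroup E] [NormedSpace ℝ E]
    [FiniteDimensional ℝ E] where
  /-- The group law. -/
  mul : E → E → E
  mul_assoc : ∀ x y z, mul (mul x y) z = mul x (mul y z)
  smul_mul_smul : ∀ (s t : ℝ) (x : E), mul (s • x) (t • x) = (s + t) • x
  contDiff_mul : ContDiff ℝ ∞ (fun p : E × E => mul p.1 p.2)
  /-- The step `s` of the stratification. -/
  step : ℕ
  one_le_step : 1 ≤ step
  /-- The layers of the stratification, indexed from `1` to `step`. -/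
  layer : ℕ → Submodule ℝ E
  /-- The Lie algebra is the direct sum of the layers. -/
  isInternal_layer : DirectSum.IsInternal (fun j : Set.Icc 1 step => layer j)
  /-- `𝔤_{j+1} = [𝔤_j, 𝔤_1]` for `1 ≤ j < s`. -/
  layer_succ : ∀ j, 1 ≤ j → j < step →
    layer (j + 1) = Submodule.span ℝ {z | ∃ v ∈ layer j, ∃ w ∈ layer 1, z = groupBracket mul v w}
  /-- `𝔤_s ≠ 0`. -/
  layer_step_ne_bot : layer step ≠ ⊥
  /-- `[𝔤_s, 𝔤] = 0`. -/
  bracket_layer_step : ∀ v ∈ layer step, ∀ w, groupBracket mul v w = 0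

namespace CarnotGroup

variable {E : Type*} [NormedAddCommGroup E] [NormedSpace ℝ E] [FiniteDimensional ℝ E]

lemma zero_mul (G : CarnotGroup E) (x : E) : G.mul 0 x = x := by
  simpa using G.smul_mul_smul 0 1 x

lemma mul_zero (G : CarnotGroup E) (x : E) : G.mul x 0 = x := by
  simpa using G.smul_mul_smul 1 0 x

lemma neg_mul_self (G : CarnotGroup E) (x : E) : G.mul (-x) x = 0 := by
  simpa using G.smul_mul_smul (-1) 1 x

/-- The left-invariant vector field of a Carnot group determined by an element of its Lie
algebra. -/
def field (G : CarnotGroup E) (v : E) : E → E := leftInvariantField G.mul v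

/-- The product law of `G × ℝ`. -/
def prodRealMul (G : CarnotGroup E) (p q : E × ℝ) : E × ℝ := (G.mul p.1 q.1, p.2 + q.2)

/-- The stratification of `𝔤 × ℝ` is `(𝔤_1 × ℝ) ⊕ (𝔤_2 × {0}) ⊕ … ⊕ (𝔤_s × {0})`. -/
def prodRealLayer (G : CarnotGroup E) (j : ℕ) : Submodule ℝ (E × ℝ) :=
  (G.layer j).prod (if j = 1 then ⊤ else ⊥)

lemma contDiff_prodRealMul (G : CarnotGroup E) :
    ContDiff ℝ ∞ (fun p : (E × ℝ) × (E × ℝ) => G.prodRealMul p.1 p.2) := by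
  have h : ContDiff ℝ ∞ (fun p : (E × ℝ) × (E × ℝ) => G.mul p.1.1 p.2.1) :=
    G.contDiff_mul.comp (f := fun p : (E × ℝ) × (E × ℝ) => (p.1.1, p.2.1)) (by fun_prop)
  exact h.prodMk (by fun_prop)

lemma leftInvariantField_prodRealMul (G : CarnotGroup E) (v x : E × ℝ) :
    leftInvariantField G.prodRealMul v x = (G.field v.1 x.1, v.2) := by
  have hd : DifferentiableAt ℝ (G.mul x.1) 0 := by
    have : ContDiff ℝ ∞ (G.mul x.1) :=
      G.contDiff_mul.comp (f := fun y : E => (x.1, y)) (by fun_prop)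
    exact (this.differentiable (by simp)).differentiableAt
  have h1 : HasFDerivAt (fun y : E × ℝ => G.mul x.1 y.1)
      ((fderiv ℝ (G.mul x.1) 0).comp (ContinuousLinearMap.fst ℝ E ℝ)) 0 :=
    HasFDerivAt.comp (f := fun y : E × ℝ => y.1) (0 : E × ℝ) hd.hasFDerivAt hasFDerivAt_fst
  have h2 : HasFDerivAt (fun y : E × ℝ => x.2 + y.2) (ContinuousLinearMap.snd ℝ E ℝ) 0 :=
    hasFDerivAt_snd.const_add x.2
  have h3 := (h1.prodMk h2).fderiv
  unfold leftInvariantField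
  have h4 : G.prodRealMul x = fun y : E × ℝ => (G.mul x.1 y.1, x.2 + y.2) := rfl
  rw [h4, h3]
  rfl

lemma groupBracket_prodRealMul (G : CarnotGroup E) (v w : E × ℝ) :
    groupBracket G.prodRealMul v w = (groupBracket G.mul v.1 w.1, 0) := by
  have key : ∀ u : E × ℝ, HasFDerivAt (leftInvariantField G.prodRealMul u)
      (((fderiv ℝ (leftInvariantField G.mul u.1) 0).comp
        (ContinuousLinearMap.fst ℝ E ℝ)).prod 0) 0 := by
    intro u
    have hd : DifferentiableAt ℝ (leftInvariantField G.mul u.1) 0 :=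
      ((contDiff_leftInvariantField G.contDiff_mul u.1).differentiable
        (by simp)).differentiableAt
    have h1 : HasFDerivAt (fun y : E × ℝ => leftInvariantField G.mul u.1 y.1)
        ((fderiv ℝ (leftInvariantField G.mul u.1) 0).comp (ContinuousLinearMap.fst ℝ E ℝ)) 0 :=
      HasFDerivAt.comp (f := fun y : E × ℝ => y.1) (0 : E × ℝ) hd.hasFDerivAt hasFDerivAt_fst
    have h2 := h1.prodMk (hasFDerivAt_const (𝕜 := ℝ) u.2 (0 : E × ℝ))
    have h3 : leftInvariantField G.prodRealMul u
        = fun y : E × ℝ => (leftInvariantField G.mul u.1 y.1, u.2) := by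
      funext y
      exact G.leftInvariantField_prodRealMul u y
    rw [h3]
    exact h2
  unfold groupBracket
  rw [VectorField.lieBracket_eq]
  simp only [(key v).fderiv, (key w).fderiv, leftInvariantField_prodRealMul]
  simp [VectorField.lieBracket_eq, field]

/-- The Carnot group `G × ℝ`. -/
def prodReal (G : CarnotGroup E) : CarnotGroup (E × ℝ) where
  mul := G.prodRealMul
  mul_assoc x y z := by simp [prodRealMul, G.mul_assoc, add_assoc]
  smul_mul_smul s t x := by
    simp [prodRealMul, G.smul_mul_smul, Prod.ext_iff, add_mul]
  contDiff_mul := G.contDiff_prodRealMul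
  step := G.step
  one_le_step := G.one_le_step
  layer := G.prodRealLayer
  isInternal_layer := by
    have hI := G.isInternal_layer
    rw [DirectSum.isInternal_submodule_iff_iSupIndep_and_iSup_eq_top] at hI ⊢
    obtain ⟨hi, hs⟩ := hI
    constructor
    · rw [iSupIndep_iff_finsetSum_eq_zero_imp_eq_zero] at hi ⊢
      intro s v hv hsum
      have hv' : ∀ i ∈ s, (v i).1 ∈ G.layer i ∧
          (v i).2 ∈ (if (i : ℕ) = 1 then (⊤ : Submodule ℝ ℝ) else ⊥) :=
        fun i hi => Submodule.mem_prod.mp (hv i hi)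
      have hz1 := hi s (fun i => (v i).1) (fun i hi => (hv' i hi).1)
        (by simpa [Prod.fst_sum] using congrArg Prod.fst hsum)
      have hsum2 : ∑ i ∈ s, (v i).2 = 0 := by
        simpa [Prod.snd_sum] using congrArg Prod.snd hsum
      have hne : ∀ j ∈ s, (j : ℕ) ≠ 1 → (v j).2 = 0 := by
        intro j hj h
        have := (hv' j hj).2
        rw [if_neg h] at this
        simpa using this
      intro i hi
      refine Prod.ext (hz1 i hi) ?_
      by_cases h : (i : ℕ) = 1
      · rw [Finset.sum_eq_single_of_mem i hi] at hsum2
        · exact hsum2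
        · intro j hj hji
          exact hne j hj (fun h' => hji (Subtype.ext (h'.trans h.symm)))
      · exact hne i hi h
    · have hle : (⊤ : Submodule ℝ E) ≤
          (⨆ j : Set.Icc 1 G.step, G.prodRealLayer j).comap (LinearMap.inl ℝ E ℝ) := by
        rw [← hs]
        refine iSup_le fun j x hx => ?_
        have : ((x, 0) : E × ℝ) ∈ G.prodRealLayer j := by
          simp [prodRealLayer, Submodule.mem_prod, hx]
        exact (le_iSup (fun j : Set.Icc 1 G.step => G.prodRealLayer j) j) this
      rw [eq_top_iff]
      rintro ⟨x, t⟩ -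
      have h1 : ((x, 0) : E × ℝ) ∈ ⨆ j : Set.Icc 1 G.step, G.prodRealLayer j :=
        hle (Submodule.mem_top : x ∈ ⊤)
      have h2 : ((0, t) : E × ℝ) ∈ ⨆ j : Set.Icc 1 G.step, G.prodRealLayer j := by
        refine (le_iSup (fun j : Set.Icc 1 G.step => G.prodRealLayer j)
          ⟨1, le_rfl, G.one_le_step⟩) ?_
        simp [prodRealLayer, Submodule.mem_prod]
      simpa using add_mem h1 h2
  layer_succ j hj hjs := by
    have hne : j + 1 ≠ 1 := by omega
    apply le_antisymm
    · rintro ⟨x, t⟩ hx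
      simp only [prodRealLayer, if_neg hne, Submodule.mem_prod, Submodule.mem_bot] at hx
      obtain ⟨hx, rfl⟩ := hx
      have hle : G.layer (j + 1) ≤ (Submodule.span ℝ {z | ∃ v ∈ G.prodRealLayer j,
          ∃ w ∈ G.prodRealLayer 1, z = groupBracket G.prodRealMul v w}).comap
            (LinearMap.inl ℝ E ℝ) := by
        rw [G.layer_succ j hj hjs, Submodule.span_le]
        rintro z ⟨v, hv, w, hw, rfl⟩
        refine Submodule.subset_span ⟨(v, 0), ?_, (w, 0), ?_, ?_⟩
        · simp [prodRealLayer, Submodule.mem_prod, hv]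
        · simp [prodRealLayer, Submodule.mem_prod, hw]
        · simp [groupBracket_prodRealMul]
      exact hle hx
    · rw [Submodule.span_le]
      rintro z ⟨v, hv, w, hw, rfl⟩
      simp only [prodRealLayer, if_neg hne, SetLike.mem_coe, Submodule.mem_prod,
        Submodule.mem_bot, groupBracket_prodRealMul, and_true]
      rw [G.layer_succ j hj hjs]
      exact Submodule.subset_span ⟨v.1, hv.1, w.1, hw.1, rfl⟩
  layer_step_ne_bot := by
    obtain ⟨x, hx, hx0⟩ := Submodule.exists_mem_ne_zero_of_ne_bot G.layer_step_ne_bot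
    intro h
    have h1 : ((x, 0) : E × ℝ) ∈ G.prodRealLayer G.step := by
      simp [prodRealLayer, Submodule.mem_prod, hx]
    rw [h] at h1
    exact hx0 (by simpa using h1)
  bracket_layer_step v hv w := by
    rw [groupBracket_prodRealMul, G.bracket_layer_step v.1 hv.1 w.1]
    rfl

end CarnotGroup

/-! ### Functions of bounded `H`-variation with respect to a family of vector fields -/

section BVH

variable {E : Type*} [NormedAddCommGroup E] [NormedSpace ℝ E] {ι : Type*} [Fintype ι]

/-- The divergence of a vector field: in linear coordinates, `∑ j, ∂_j (F_j)`. -/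
def euclideanDiv (F : E → E) (x : E) : ℝ := LinearMap.trace ℝ E (fderiv ℝ F x).toLinearMap

/-- The `X`-divergence `div_X φ = ∑ i, div (φ_i X_i) = ∑ i, ∑ j, ∂_j (a_ij φ_i)` of a tuple of
functions `φ`, where `X_i = ∑ j, a_ij ∂_j`. Up to the sign, `φ_i ↦ div (φ_i X_i)` is the formal
adjoint of `X_i` with respect to the Lebesgue measure. -/
def divX (X : ι → E → E) (φ : E → ι → ℝ) (x : E) : ℝ :=
  ∑ i, euclideanDiv (fun y => φ y i • X i y) x

variable [MeasureSpace E]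

/-- The distributional derivative `D_H u` of `u` in `Ω` along the family `X` is an `ℝ^ι`-valued
Borel measure of finite total variation on `Ω`:
`∫_Ω φ · d(D_H u) = - ∫_Ω u div_X φ` for all `φ ∈ C_c^1(Ω; ℝ^ι)`.

The components of `D_H u` are signed measures on `E`, of which only the restriction to `Ω` is
relevant as `φ` is supported in `Ω`; signed measures are real-valued, and so they have finite total
variation. -/
def HasFiniteHVariation (X : ι → E → E) (Ω : Set E) (u : E → ℝ) : Prop :=
  ∃ D : ι → SignedMeasure E, ∀ φ : E → ι → ℝ,
    ContDiff ℝ 1 φ → HasCompactSupport φ → tsupport φ ⊆ Ω →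
      ∑ i, ∫ᵛ x, φ x i ∂•(D i) = - ∫ x in Ω, u x * divX X φ x

/-- `u ∈ BV_H(Ω)`: `u ∈ L¹(Ω)`, and `D_H u` is a measure of finite total variation on `Ω`. -/
def MemBVH (X : ι → E → E) (Ω : Set E) (u : E → ℝ) : Prop :=
  IntegrableOn u Ω ∧ HasFiniteHVariation X Ω u

/-- `S` has finite `H`-perimeter in `Ω`: the characteristic function of `S` is in `L¹_loc(Ω)`, and
its distributional derivative along `X` is a measure of finite total variation on `Ω`. -/
def HasFiniteHPerimeter (X : ι → E → E) (Ω : Set E) (S : Set E) : Prop :=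
  LocallyIntegrableOn (S.indicator (fun _ => (1 : ℝ))) Ω ∧
    HasFiniteHVariation X Ω (S.indicator (fun _ => (1 : ℝ)))

end BVH

/-- The subgraph `E_u = {(x, t) ∈ Ω × ℝ : t < u x}` of a function `u` on `Ω`. -/
def subgraphOn {E : Type*} (Ω : Set E) (u : E → ℝ) : Set (E × ℝ) :=
  {p | p.1 ∈ Ω ∧ p.2 < u p.1}

end

/-!
The field `G.field v` generates the flow `Φ s x = x · exp (s v)`. A function `u` has finite
variation along the generator of a flow if and only if its difference quotients `h⁻¹ (u ∘ Φ h - u)`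
are bounded in `L¹`: transporting a test function along the flow and differentiating in time bounds
the quotients by the variation, and conversely a weak limit of the quotients as `h → 0` is the
distributional derivative.

This criterion passes between `u` and its subgraph. The left-invariant field of `G × ℝ` given by
`(v, c)` generates the flow `(x, t) ↦ (Φ s x, t + s c)`, and, by integrating along vertical lines,
the difference of the characteristic function `χ` of the subgraph along it has `L¹` norm
`∫ |χ (Φ h x, t + h c) - χ (x, t)| dx dt = ∫ |u (Φ h x) - u x - h c| dx`,
where the term `h c` contributes at most `h |c| vol(Ω)`.
-/

open Set Filter Topology

section FieldVariation

variable {E : Type*} [NormedAddCommGroup E] [NormedSpace ℝ E] {Z W : E → E} {φ : E → ℝ} {x : E}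

lemma euclideanDiv_add (hZ : DifferentiableAt ℝ Z x) (hW : DifferentiableAt ℝ W x) :
    euclideanDiv (fun y => Z y + W y) x = euclideanDiv Z x + euclideanDiv W x := by
  simp [euclideanDiv, fderiv_fun_add hZ hW]

lemma tsupport_euclideanDiv_subset : tsupport (euclideanDiv Z) ⊆ tsupport Z := by
  refine closure_minimal (fun x hx => ?_) (isClosed_tsupport Z)
  contrapose! hx
  simp [euclideanDiv, fderiv_of_notMem_tsupport ℝ hx]

lemma continuous_euclideanDiv [FiniteDimensional ℝ E] (hZ : ContDiff ℝ 1 Z) :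
    Continuous (euclideanDiv Z) :=
  (LinearMap.continuous_of_finiteDimensional
    (LinearMap.trace ℝ E ∘ₗ ContinuousLinearMap.coeLM ℝ)).comp (hZ.continuous_fderiv one_ne_zero)

lemma euclideanDiv_smul [FiniteDimensional ℝ E] (hφ : DifferentiableAt ℝ φ x)
    (hZ : DifferentiableAt ℝ Z x) :
    euclideanDiv (fun y => φ y • Z y) x = φ x * euclideanDiv Z x + fderiv ℝ φ x (Z x) := by
  simp [euclideanDiv, fderiv_fun_smul hφ hZ, LinearMap.trace_smulRight]

variable {ι : Type*} [Fintype ι] {X : ι → E → E}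

lemma divX_single [DecidableEq ι] (φ : E → ℝ) (i : ι) (x : E) :
    divX X (fun y => Pi.single i (φ y)) x = euclideanDiv (fun y => φ y • X i y) x := by
  rw [divX, Finset.sum_eq_single_of_mem i (Finset.mem_univ i)]
  · simp
  · intro j _ hj
    simp [Pi.single_eq_of_ne hj, euclideanDiv]

instance isFiniteMeasure_variation {α : Type*} [MeasurableSpace α] (D : SignedMeasure α) :
    IsFiniteMeasure D.variation := by
  rw [← D.totalVariation_eq_variation, SignedMeasure.totalVariation]
  infer_instance

variable [MeasureSpace E]

/-- The distributional derivative of `u` in `Ω` along the single vector field `Z` is a finite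
signed measure. -/
def HasFiniteFieldVariation (Z : E → E) (Ω : Set E) (u : E → ℝ) : Prop :=
  ∃ D : SignedMeasure E, ∀ φ : E → ℝ, ContDiff ℝ 1 φ → HasCompactSupport φ → tsupport φ ⊆ Ω →
    ∫ᵛ x, φ x ∂•D = - ∫ x in Ω, u x * euclideanDiv (fun y => φ y • Z y) x

variable {Ω : Set E} {u v : E → ℝ}

lemma HasFiniteFieldVariation.congr_ae (h : HasFiniteFieldVariation Z Ω u)
    (huv : u =ᵐ[volume.restrict Ω] v) : HasFiniteFieldVariation Z Ω v := by
  obtain ⟨D, hD⟩ := h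
  refine ⟨D, fun φ hφ hφc hφΩ => (hD φ hφ hφc hφΩ).trans (congrArg Neg.neg ?_)⟩
  exact integral_congr_ae (huv.mul (EventuallyEq.refl _ _))

lemma HasFiniteFieldVariation.const_smul (c : ℝ) (h : HasFiniteFieldVariation Z Ω u) :
    HasFiniteFieldVariation (fun x => c • Z x) Ω u := by
  obtain ⟨D, hD⟩ := h
  refine ⟨c • D, fun φ hφ hφc hφΩ => ?_⟩
  have hcφ := hD (fun x => c * φ x) (contDiff_const.mul hφ) hφc.mul_left
    ((tsupport_mul_subset_right (f := fun _ => c)).trans hφΩ)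
  simp_rw [smul_smul, mul_comm _ c, ← hcφ]
  rw [VectorMeasure.integral_smul_vectorMeasure]
  exact (VectorMeasure.integral_fun_smul D _ c φ).symm

lemma HasFiniteHVariation.hasFiniteFieldVariation (h : HasFiniteHVariation X Ω u) (i : ι) :
    HasFiniteFieldVariation (X i) Ω u := by
  classical
  obtain ⟨D, hD⟩ := h
  refine ⟨D i, fun φ hφ hφc hφΩ => ?_⟩
  have hsmooth : ContDiff ℝ 1 fun x => (Pi.single i (φ x) : ι → ℝ) :=
    (LinearMap.toContinuousLinearMap (LinearMap.single ℝ (fun _ : ι => ℝ) i)).contDiff.comp hφ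
  have hsingle := hD (fun x => Pi.single i (φ x)) hsmooth
    (hφc.comp_left (g := fun t => (Pi.single i t : ι → ℝ)) (Pi.single_zero i))
    ((tsupport_comp_subset (g := fun t => (Pi.single i t : ι → ℝ)) (Pi.single_zero i) φ).trans hφΩ)
  simp_rw [divX_single] at hsingle
  rw [← hsingle, Finset.sum_eq_single_of_mem i (Finset.mem_univ i)]
  · simp
  · intro j _ hj
    simp [Pi.single_eq_of_ne hj]

variable [BorelSpace E] [FiniteDimensional ℝ E]

lemma integrableOn_mul_euclideanDiv (hu : LocallyIntegrableOn u Ω) (hZ : ContDiff ℝ 1 Z)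
    (hZc : HasCompactSupport Z) (hZΩ : tsupport Z ⊆ Ω) :
    IntegrableOn (fun x => u x * euclideanDiv Z x) Ω := by
  have hK : IntegrableOn (fun x => u x * euclideanDiv Z x) (tsupport Z) :=
    (hu.integrableOn_compact_subset hZΩ hZc).mul_continuousOn
      (continuous_euclideanDiv hZ).continuousOn hZc
  rw [integrableOn_iff_integrable_of_support_subset] at hK
  · exact hK.integrableOn
  · exact (Function.support_mul_subset_right _ _).trans
      ((subset_tsupport _).trans tsupport_euclideanDiv_subset)

lemma integrableOn_mul_euclideanDiv_smul (hu : LocallyIntegrableOn u Ω) (hZ : ContDiff ℝ 1 Z)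
    (hφ : ContDiff ℝ 1 φ) (hφc : HasCompactSupport φ) (hφΩ : tsupport φ ⊆ Ω) :
    IntegrableOn (fun x => u x * euclideanDiv (fun y => φ y • Z y) x) Ω :=
  integrableOn_mul_euclideanDiv hu (hφ.smul hZ) hφc.smul_right
    ((tsupport_smul_subset_left φ Z).trans hφΩ)

lemma HasFiniteFieldVariation.add (hu : LocallyIntegrableOn u Ω) (hZ : ContDiff ℝ 1 Z)
    (hW : ContDiff ℝ 1 W) (h : HasFiniteFieldVariation Z Ω u)
    (h' : HasFiniteFieldVariation W Ω u) :
    HasFiniteFieldVariation (fun x => Z x + W x) Ω u := by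
  obtain ⟨D, hD⟩ := h
  obtain ⟨D', hD'⟩ := h'
  refine ⟨D + D', fun φ hφ hφc hφΩ => ?_⟩
  have hint (T : SignedMeasure E) : T.Integrable φ :=
    hφ.continuous.integrable_of_hasCompactSupport hφc
  have hdiv (x : E) : euclideanDiv (fun y => φ y • (Z y + W y)) x
      = euclideanDiv (fun y => φ y • Z y) x + euclideanDiv (fun y => φ y • W y) x := by
    simp_rw [smul_add]
    exact euclideanDiv_add ((hφ.smul hZ).differentiable one_ne_zero x)
      ((hφ.smul hW).differentiable one_ne_zero x)
  simp_rw [hdiv, mul_add]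
  rw [VectorMeasure.integral_add_vectorMeasure (hint D) (hint D'), hD φ hφ hφc hφΩ,
    hD' φ hφ hφc hφΩ, integral_add (integrableOn_mul_euclideanDiv_smul hu hZ hφ hφc hφΩ)
    (integrableOn_mul_euclideanDiv_smul hu hW hφ hφc hφΩ), neg_add]

lemma hasFiniteHVariation_iff (hu : LocallyIntegrableOn u Ω) (hX : ∀ i, ContDiff ℝ 1 (X i)) :
    HasFiniteHVariation X Ω u ↔ ∀ i, HasFiniteFieldVariation (X i) Ω u := by
  refine ⟨fun h i => h.hasFiniteFieldVariation i, fun h => ?_⟩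
  choose D hD using h
  refine ⟨D, fun φ hφ hφc hφΩ => ?_⟩
  have hφi (i : ι) : ContDiff ℝ 1 fun x => φ x i := contDiff_pi.1 hφ i
  have hφci (i : ι) : HasCompactSupport fun x => φ x i :=
    hφc.comp_left (g := fun t : ι → ℝ => t i) rfl
  have hφΩi (i : ι) : tsupport (fun x => φ x i) ⊆ Ω :=
    (tsupport_comp_subset (g := fun t : ι → ℝ => t i) rfl φ).trans hφΩ
  simp only [divX, Finset.mul_sum]
  rw [integral_finsetSum _ fun i _ =>
    integrableOn_mul_euclideanDiv_smul hu (hX i) (hφi i) (hφci i) (hφΩi i),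
    ← Finset.sum_neg_distrib]
  exact Finset.sum_congr rfl fun i _ => hD i _ (hφi i) (hφci i) (hφΩi i)

lemma hasFiniteHVariation_basis_iff {V : Type*} [AddCommGroup V] [Module ℝ V]
    (b : Module.Basis ι ℝ V) {Z : V → E → E} (hu : LocallyIntegrableOn u Ω)
    (hZ : ∀ v, ContDiff ℝ 1 (Z v)) (hadd : ∀ v w, Z (v + w) = fun x => Z v x + Z w x)
    (hsmul : ∀ (c : ℝ) v, Z (c • v) = fun x => c • Z v x) :
    HasFiniteHVariation (fun i => Z (b i)) Ω u ↔ ∀ v, HasFiniteFieldVariation (Z v) Ω u := by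
  rw [hasFiniteHVariation_iff hu fun i => hZ _]
  refine ⟨fun h v => ?_, fun h i => h _⟩
  have hv : v ∈ Submodule.span ℝ (range b) := b.span_eq ▸ Submodule.mem_top
  induction hv using Submodule.span_induction with
  | mem _ hx => obtain ⟨i, rfl⟩ := hx; exact h i
  | zero =>
    refine ⟨0, fun φ _ _ _ => ?_⟩
    have h0 : Z 0 = fun _ => 0 := by simpa using hsmul 0 0
    simp [h0, euclideanDiv]
  | add v w _ _ hv hw => rw [hadd]; exact hv.add hu (hZ v) (hZ w) hw
  | smul c v _ hv => rw [hsmul]; exact hv.const_smul c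

end FieldVariation

section Flow

variable {E : Type*} [NormedAddCommGroup E] [NormedSpace ℝ E]

section Determinant

variable [FiniteDimensional ℝ E]

lemma contDiff_det {n : WithTop ℕ∞} : ContDiff ℝ n fun A : E →L[ℝ] E => A.det := by
  classical
  let b := Module.finBasis ℝ E
  have hdet (A : E →L[ℝ] E) : A.det = ∑ σ : Equiv.Perm (Fin (Module.finrank ℝ E)),
      Equiv.Perm.sign σ • ∏ i, LinearMap.toContinuousLinearMap (b.coord (σ i)) (A (b i)) := by
    rw [ContinuousLinearMap.det, ← LinearMap.det_toMatrix b, Matrix.det_apply]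
    simp [LinearMap.toMatrix_apply]
  simp_rw [hdet]
  fun_prop

lemma hasDerivAt_det_one_add_smul (A : E →L[ℝ] E) :
    HasDerivAt (fun s : ℝ => (1 + s • A).det) (LinearMap.trace ℝ E A.toLinearMap) 0 := by
  classical
  let b := Module.finBasis ℝ E
  let M := LinearMap.toMatrix b b A.toLinearMap
  let p := (1 + (Polynomial.X : Polynomial ℝ) • M.map Polynomial.C).det.divX.divX
  have hdet (s : ℝ) : (1 + s • A).det = 1 + M.trace * s + p.eval s * s ^ 2 := by
    rw [← Matrix.det_one_add_smul, ContinuousLinearMap.det, ← LinearMap.det_toMatrix b]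
    simp [M]
  rw [LinearMap.trace_eq_matrix_trace ℝ b, funext hdet]
  have htaylor := (((hasDerivAt_id' (0 : ℝ)).const_mul M.trace).const_add 1).add
    ((p.hasDerivAt 0).mul ((hasDerivAt_id' (0 : ℝ)).fun_pow 2))
  exact htaylor.congr_deriv (by simp [M])

lemma fderiv_det_one (A : E →L[ℝ] E) :
    fderiv ℝ (fun B : E →L[ℝ] E => B.det) 1 A = LinearMap.trace ℝ E A.toLinearMap := by
  have hline : HasDerivAt (fun s : ℝ => (1 : E →L[ℝ] E) + s • A) A 0 := by
    simpa using ((hasDerivAt_id (0 : ℝ)).smul_const A).const_add 1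
  have hdet : HasFDerivAt (fun B : E →L[ℝ] E => B.det) _ (1 + (0 : ℝ) • A) :=
    (contDiff_det.differentiable one_ne_zero _).hasFDerivAt
  have h := HasDerivAt.unique
    (HasFDerivAt.comp_hasDerivAt (f := fun s : ℝ => 1 + s • A) 0 hdet hline)
    (hasDerivAt_det_one_add_smul A)
  simpa using h

end Determinant

/-- `Φ` is a flow of class `C²` whose infinitesimal generator is the vector field `Z`. -/
structure IsFlowOf (Φ : Flow ℝ E) (Z : E → E) : Prop where
  contDiff : ContDiff ℝ 2 fun p : ℝ × E => Φ p.1 p.2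
  hasDerivAt_zero : ∀ x, HasDerivAt (fun s => Φ s x) (Z x) 0

/-- The Jacobian determinant of the time-`s` map of a flow. -/
noncomputable def flowJacobian (Φ : Flow ℝ E) (s : ℝ) (x : E) : ℝ := (fderiv ℝ (Φ s) x).det

/-- The density of the push-forward of `φ dx` under the time-`s` map of a flow. -/
noncomputable def pushDensity (Φ : Flow ℝ E) (s : ℝ) (φ : E → ℝ) (y : E) : ℝ :=
  flowJacobian Φ (-s) y * φ (Φ (-s) y)

lemma pushDensity_zero (Φ : Flow ℝ E) (φ : E → ℝ) : pushDensity Φ 0 φ = φ := by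
  ext y
  simp [pushDensity, flowJacobian, ContinuousLinearMap.det]

namespace IsFlowOf

variable {Φ : Flow ℝ E} {Z : E → E} (hΦ : IsFlowOf Φ Z)
include hΦ

lemma hasFDerivAt_joint (p : ℝ × E) : HasFDerivAt (fun p : ℝ × E => Φ p.1 p.2)
    (fderiv ℝ (fun p : ℝ × E => Φ p.1 p.2) p) p :=
  (hΦ.contDiff.differentiable two_ne_zero p).hasFDerivAt

lemma hasFDerivAt_time (s : ℝ) (x : E) : HasFDerivAt (Φ s)
    ((fderiv ℝ (fun p : ℝ × E => Φ p.1 p.2) (s, x)).comp (ContinuousLinearMap.inr ℝ ℝ E)) x :=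
  (hΦ.hasFDerivAt_joint (s, x)).comp x (hasFDerivAt_prodMk_right s x)

lemma differentiableAt (s : ℝ) (x : E) : DifferentiableAt ℝ (Φ s) x :=
  (hΦ.hasFDerivAt_time s x).differentiableAt

lemma generator_eq (x : E) :
    Z x = fderiv ℝ (fun p : ℝ × E => Φ p.1 p.2) (0, x) (1, 0) :=
  (hΦ.hasDerivAt_zero x).unique <|
    HasFDerivAt.comp_hasDerivAt (f := fun s : ℝ => (s, x)) 0 (hΦ.hasFDerivAt_joint (0, x))
      ((hasDerivAt_id (0 : ℝ)).prodMk (hasDerivAt_const (0 : ℝ) x))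

lemma contDiff_fderiv : ContDiff ℝ 1 (fderiv ℝ fun p : ℝ × E => Φ p.1 p.2) :=
  hΦ.contDiff.fderiv_right (by norm_num)

lemma contDiff_generator : ContDiff ℝ 1 Z := by
  rw [funext hΦ.generator_eq]
  exact (hΦ.contDiff_fderiv.comp (contDiff_const.prodMk contDiff_id)).clm_apply contDiff_const

lemma hasDerivAt_fderiv (x : E) :
    HasDerivAt (fun s => fderiv ℝ (Φ s) x) (fderiv ℝ Z x) 0 := by
  let f := fun p : ℝ × E => Φ p.1 p.2
  have hf' : HasFDerivAt (fderiv ℝ f) (fderiv ℝ (fderiv ℝ f) (0, x)) (0, x) :=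
    (hΦ.contDiff_fderiv.differentiable one_ne_zero _).hasFDerivAt
  have htime : HasDerivAt (fun s => fderiv ℝ (Φ s) x)
      ((fderiv ℝ (fderiv ℝ f) (0, x) (1, 0)).comp (ContinuousLinearMap.inr ℝ ℝ E)) 0 := by
    simp_rw [fun s => (hΦ.hasFDerivAt_time s x).fderiv]
    have hcurve := HasFDerivAt.comp_hasDerivAt (f := fun s : ℝ => (s, x)) 0 hf'
      ((hasDerivAt_id (0 : ℝ)).prodMk (hasDerivAt_const (0 : ℝ) x))
    exact (HasDerivAt.clm_comp (c := fun s => fderiv ℝ f (s, x)) hcurve (hasDerivAt_const (0 : ℝ)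
      (ContinuousLinearMap.inr ℝ ℝ E))).congr_deriv (by simp)
  have hspace : HasFDerivAt Z ((ContinuousLinearMap.apply ℝ E ((1, 0) : ℝ × E)).comp
      ((fderiv ℝ (fderiv ℝ f) (0, x)).comp (ContinuousLinearMap.inr ℝ ℝ E))) x := by
    rw [funext hΦ.generator_eq]
    exact (ContinuousLinearMap.apply ℝ E ((1, 0) : ℝ × E)).hasFDerivAt.comp x
      (hf'.comp x (hasFDerivAt_prodMk_right (0 : ℝ) x))
  refine htime.congr_deriv (ContinuousLinearMap.ext fun w => ?_)
  have hsymm := (hΦ.contDiff.contDiffAt (x := (0, x))).isSymmSndFDerivAt (by simp)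
  simpa [hspace.fderiv] using hsymm.eq (1, 0) (0, w)

lemma contDiff_flowJacobian [FiniteDimensional ℝ E] :
    ContDiff ℝ 1 fun p : ℝ × E => flowJacobian Φ p.1 p.2 := by
  simp_rw [flowJacobian, fun p : ℝ × E => (hΦ.hasFDerivAt_time p.1 p.2).fderiv]
  exact contDiff_det.comp (hΦ.contDiff_fderiv.clm_comp contDiff_const)

lemma flowJacobian_add (s t : ℝ) (x : E) :
    flowJacobian Φ (s + t) x = flowJacobian Φ s (Φ t x) * flowJacobian Φ t x := by
  have hcomp : Φ (s + t) = Φ s ∘ Φ t := funext (Φ.map_add s t)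
  rw [flowJacobian, hcomp, fderiv_comp x (hΦ.differentiableAt s _) (hΦ.differentiableAt t x)]
  exact LinearMap.det_comp _ _

lemma flowJacobian_pos [FiniteDimensional ℝ E] (s : ℝ) (x : E) : 0 < flowJacobian Φ s x := by
  have hzero : flowJacobian Φ 0 x = 1 := by simp [flowJacobian, ContinuousLinearMap.det]
  have hne (t : ℝ) : flowJacobian Φ t x ≠ 0 := fun h => by
    have := hΦ.flowJacobian_add (-t) t x
    simp [hzero, h] at this
  have hcont : Continuous fun t => flowJacobian Φ t x :=
    hΦ.contDiff_flowJacobian.continuous.comp (f := fun t => (t, x)) (by fun_prop)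
  by_contra! hs
  obtain ⟨t, ht⟩ := mem_range_of_exists_le_of_exists_ge hcont ⟨s, hs⟩ ⟨0, hzero ▸ zero_le_one⟩
  exact hne t ht

lemma hasDerivAt_flowJacobian_zero [FiniteDimensional ℝ E] (x : E) :
    HasDerivAt (fun s => flowJacobian Φ s x) (euclideanDiv Z x) 0 := by
  have hone : fderiv ℝ (Φ 0) x = 1 := by simp [ContinuousLinearMap.one_def]
  have hdet : HasFDerivAt (fun B : E →L[ℝ] E => B.det) _ (fderiv ℝ (Φ 0) x) :=
    (contDiff_det.differentiable one_ne_zero _).hasFDerivAt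
  have h := hdet.comp_hasDerivAt (0 : ℝ) (hΦ.hasDerivAt_fderiv x)
  rwa [hone, fderiv_det_one] at h

lemma pushDensity_add (s t : ℝ) (φ : E → ℝ) :
    pushDensity Φ (s + t) φ = pushDensity Φ t (pushDensity Φ s φ) := by
  ext y
  rw [pushDensity, neg_add, hΦ.flowJacobian_add, Φ.map_add, pushDensity, pushDensity]
  ring

variable [FiniteDimensional ℝ E] {φ : E → ℝ} (hφ : ContDiff ℝ 1 φ)
include hφ

lemma contDiff_pushDensity_joint : ContDiff ℝ 1 fun p : ℝ × E => pushDensity Φ p.1 φ p.2 := by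
  have hneg : ContDiff ℝ 1 fun p : ℝ × E => (-p.1, p.2) := by fun_prop
  exact (hΦ.contDiff_flowJacobian.comp hneg).mul
    (hφ.comp ((hΦ.contDiff.of_le one_le_two).comp hneg))

lemma contDiff_pushDensity (s : ℝ) : ContDiff ℝ 1 (pushDensity Φ s φ) :=
  (hΦ.contDiff_pushDensity_joint hφ).comp (contDiff_const.prodMk contDiff_id)

lemma hasDerivAt_pushDensity_zero (y : E) : HasDerivAt (fun s => pushDensity Φ s φ y)
    (-euclideanDiv (fun x => φ x • Z x) y) 0 := by
  have hJ : HasDerivAt (fun s => flowJacobian Φ (-s) y) (-euclideanDiv Z y) 0 := by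
    simpa [Function.comp_def] using
      HasDerivAt.scomp_of_eq (0 : ℝ) (hΦ.hasDerivAt_flowJacobian_zero y)
      (hasDerivAt_neg (0 : ℝ)) neg_zero.symm
  have hΦy : HasDerivAt (fun s => Φ (-s) y) (-Z y) 0 := by
    simpa [Function.comp_def] using HasDerivAt.scomp_of_eq (0 : ℝ) (hΦ.hasDerivAt_zero y)
      (hasDerivAt_neg (0 : ℝ)) neg_zero.symm
  have hφy := ((hφ.differentiable one_ne_zero _).hasFDerivAt).comp_hasDerivAt (0 : ℝ) hΦy
  refine (hJ.mul hφy).congr_deriv ?_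
  rw [euclideanDiv_smul (hφ.differentiable one_ne_zero y)
    (hΦ.contDiff_generator.differentiable one_ne_zero y)]
  simp [flowJacobian, ContinuousLinearMap.det]
  ring

lemma hasDerivAt_pushDensity (s : ℝ) (y : E) : HasDerivAt (fun s => pushDensity Φ s φ y)
    (-euclideanDiv (fun x => pushDensity Φ s φ x • Z x) y) s := by
  have h := hΦ.hasDerivAt_pushDensity_zero (hΦ.contDiff_pushDensity hφ s) y
  rw [← sub_self s] at h
  refine (h.comp_sub_const s s).congr_of_eventuallyEq (Eventually.of_forall fun t => ?_)
  simp only [← hΦ.pushDensity_add, add_sub_cancel]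

end IsFlowOf
end Flow

section FlowIntegral

variable {E : Type*} [NormedAddCommGroup E] [NormedSpace ℝ E]

lemma support_pushDensity_subset (Φ : Flow ℝ E) (s : ℝ) (φ : E → ℝ) :
    Function.support (pushDensity Φ s φ) ⊆ Φ s '' tsupport φ := fun y hy =>
  ⟨Φ (-s) y, subset_tsupport φ (right_ne_zero_of_mul hy), by simp [← Φ.map_add]⟩

lemma tsupport_pushDensity_subset {Φ : Flow ℝ E} {φ : E → ℝ} (hφ : HasCompactSupport φ) (s : ℝ) :
    tsupport (pushDensity Φ s φ) ⊆ Φ s '' tsupport φ :=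
  closure_minimal (support_pushDensity_subset Φ s φ)
    (hφ.isCompact.image (Φ.continuous_toFun s)).isClosed

lemma hasCompactSupport_pushDensity {Φ : Flow ℝ E} {φ : E → ℝ} (hφ : HasCompactSupport φ) (s : ℝ) :
    HasCompactSupport (pushDensity Φ s φ) :=
  (hφ.isCompact.image (Φ.continuous_toFun s)).of_isClosed_subset (isClosed_tsupport _)
    (tsupport_pushDensity_subset hφ s)

open scoped NNReal in
lemma IsFlowOf.norm_pushDensity_le [FiniteDimensional ℝ E] {Φ : Flow ℝ E} {Z : E → E}
    (hΦ : IsFlowOf Φ Z) {Ω : Set E} {φ : E → ℝ} {M : ℝ≥0} {s : ℝ}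
    (hM : ∀ y ∈ Ω, flowJacobian Φ (-s) y ≤ M) (hφ : ∀ x, ‖φ x‖ ≤ 1)
    (hφΩ : Φ s '' tsupport φ ⊆ Ω) (y : E) : ‖pushDensity Φ s φ y‖ ≤ M := by
  by_cases hy : y ∈ Ω
  · rw [pushDensity, norm_mul, Real.norm_of_nonneg (hΦ.flowJacobian_pos _ _).le]
    exact (mul_le_of_le_one_right (hΦ.flowJacobian_pos _ _).le (hφ _)).trans (hM y hy)
  · rw [Function.notMem_support.1 fun h => hy (hφΩ (support_pushDensity_subset Φ s φ h)), norm_zero]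
    exact M.2

variable [MeasureSpace E] [BorelSpace E]

lemma hasDerivAt_integral_mul_of_contDiff {u : E → ℝ} {f : ℝ × E → ℝ} {K : Set E} {s : ℝ}
    (hK : IsCompact K) (hu : IntegrableOn u K) (hf : ContDiff ℝ 1 f) :
    HasDerivAt (fun t => ∫ x in K, u x * f (t, x))
      (∫ x in K, u x * fderiv ℝ f (s, x) (1, 0)) s := by
  have hf' (x : E) (t : ℝ) : HasDerivAt (fun t => f (t, x)) (fderiv ℝ f (t, x) (1, 0)) t :=
    HasFDerivAt.comp_hasDerivAt (f := fun t : ℝ => (t, x)) t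
      (hf.differentiable one_ne_zero (t, x)).hasFDerivAt
      ((hasDerivAt_id t).prodMk (hasDerivAt_const t x))
  have hcont : Continuous fun p => fderiv ℝ f p (1, 0) :=
    (hf.continuous_fderiv one_ne_zero).clm_apply continuous_const
  obtain ⟨B, hB⟩ := ((isCompact_Icc (a := s - 1) (b := s + 1)).prod hK).exists_bound_of_continuousOn
    hcont.continuousOn
  have hint {g : E → ℝ} (hg : Continuous g) : IntegrableOn (fun x => u x * g x) K :=
    hu.mul_continuousOn hg.continuousOn hK
  have hft (t : ℝ) : Continuous fun x => f (t, x) := hf.continuous.comp (by fun_prop)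
  refine (hasDerivAt_integral_of_dominated_loc_of_deriv_le (bound := fun x => ‖u x‖ * B)
    (Icc_mem_nhds (sub_one_lt s) (lt_add_one s))
    (Eventually.of_forall fun t => (hint (hft t)).aestronglyMeasurable) (hint (hft s))
    (hint (hcont.comp (by fun_prop))).aestronglyMeasurable ?_ (hu.norm.mul_const B)
    (Eventually.of_forall fun x t _ => (hf' x t).const_mul (u x))).2
  filter_upwards [ae_restrict_mem hK.measurableSet] with x hx t ht
  rw [norm_mul]
  exact mul_le_mul_of_nonneg_left (hB (t, x) ⟨ht, hx⟩) (norm_nonneg _)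

variable [FiniteDimensional ℝ E]

namespace IsFlowOf

variable {Φ : Flow ℝ E} {Z : E → E} (hΦ : IsFlowOf Φ Z) {u φ : E → ℝ}
include hΦ

lemma hasDerivAt_integral_mul_pushDensity (hu : LocallyIntegrable u) (hφ : ContDiff ℝ 1 φ)
    (hφc : HasCompactSupport φ) (s : ℝ) :
    HasDerivAt (fun t => ∫ x, u x * pushDensity Φ t φ x)
      (-∫ x, u x * euclideanDiv (fun y => pushDensity Φ s φ y • Z y) x) s := by
  let K : Set E := (fun p : ℝ × E => Φ p.1 p.2) '' (Icc (s - 1) (s + 1) ×ˢ tsupport φ)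
  have hK : IsCompact K := (isCompact_Icc.prod hφc).image hΦ.contDiff.continuous
  have hsub {t : ℝ} (ht : t ∈ Icc (s - 1) (s + 1)) : Φ t '' tsupport φ ⊆ K := by
    rintro _ ⟨x, hx, rfl⟩
    exact ⟨(t, x), ⟨ht, hx⟩, rfl⟩
  have hdiv (x : E) : fderiv ℝ (fun p : ℝ × E => pushDensity Φ p.1 φ p.2) (s, x) (1, 0)
      = -euclideanDiv (fun y => pushDensity Φ s φ y • Z y) x :=
    (HasFDerivAt.comp_hasDerivAt (f := fun t : ℝ => (t, x)) s
      ((hΦ.contDiff_pushDensity_joint hφ).differentiable one_ne_zero (s, x)).hasFDerivAt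
      ((hasDerivAt_id s).prodMk (hasDerivAt_const s x))).unique (hΦ.hasDerivAt_pushDensity hφ s x)
  have hderiv := hasDerivAt_integral_mul_of_contDiff (s := s) hK (hu.integrableOn_isCompact hK)
    (hΦ.contDiff_pushDensity_joint hφ)
  simp_rw [hdiv, mul_neg, integral_neg] at hderiv
  rw [setIntegral_eq_integral_of_forall_compl_eq_zero] at hderiv
  · refine hderiv.congr_of_eventuallyEq ?_
    filter_upwards [Icc_mem_nhds (sub_one_lt s) (lt_add_one s)] with t ht
    refine (setIntegral_eq_integral_of_forall_compl_eq_zero fun x hx => ?_).symm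
    rw [Function.notMem_support.1 fun h => hx (hsub ht (support_pushDensity_subset Φ t φ h)),
      mul_zero]
  · intro x hx
    have hx' : x ∉ tsupport (euclideanDiv fun y => pushDensity Φ s φ y • Z y) := fun h =>
      hx (hsub ⟨by linarith, by linarith⟩ (tsupport_pushDensity_subset hφc s
        (tsupport_smul_subset_left _ Z (tsupport_euclideanDiv_subset h))))
    rw [image_eq_zero_of_notMem_tsupport hx', mul_zero]

variable [(volume : Measure E).IsAddHaarMeasure]

lemma integral_comp_mul (s : ℝ) (u φ : E → ℝ) :
    ∫ x, u (Φ s x) * φ x = ∫ y, u y * pushDensity Φ s φ y := by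
  have hinj : Function.Injective (Φ (-s)) := (Φ.toHomeomorph (-s)).injective
  have hsurj : Function.Surjective (Φ (-s)) := (Φ.toHomeomorph (-s)).surjective
  have hchange := integral_image_eq_integral_abs_det_fderiv_smul volume MeasurableSet.univ
    (fun y _ => (hΦ.differentiableAt (-s) y).hasFDerivAt.hasFDerivWithinAt) hinj.injOn
    fun x => u (Φ s x) * φ x
  rw [image_univ_of_surjective hsurj, setIntegral_univ, setIntegral_univ] at hchange
  refine hchange.trans (integral_congr_ae (Eventually.of_forall fun y => ?_))
  change |flowJacobian Φ (-s) y| • (u (Φ s (Φ (-s) y)) * φ (Φ (-s) y))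
    = u y * (flowJacobian Φ (-s) y * φ (Φ (-s) y))
  rw [abs_of_pos (hΦ.flowJacobian_pos _ _), ← Φ.map_add, add_neg_cancel, Φ.map_zero_apply,
    smul_eq_mul]
  ring

lemma locallyIntegrable_comp (hu : LocallyIntegrable u) (s : ℝ) :
    LocallyIntegrable fun x => u (Φ s x) := by
  rw [locallyIntegrable_iff]
  intro K hK
  have hJ : Continuous (flowJacobian Φ s) :=
    hΦ.contDiff_flowJacobian.continuous.comp (f := fun x => (s, x)) (by fun_prop)
  have hchange := (integrableOn_image_iff_integrableOn_abs_det_fderiv_smul volume hK.measurableSet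
    (fun x _ => (hΦ.differentiableAt s x).hasFDerivAt.hasFDerivWithinAt)
    (Φ.toHomeomorph s).injective.injOn u).1
    (hu.integrableOn_isCompact (hK.image (Φ.continuous_toFun s)))
  refine (hchange.continuousOn_mul (hJ.inv₀ fun x => (hΦ.flowJacobian_pos s x).ne').continuousOn
    hK).congr (Eventually.of_forall fun x => ?_)
  change (flowJacobian Φ s x)⁻¹ * (|flowJacobian Φ s x| • u (Φ s x)) = u (Φ s x)
  rw [abs_of_pos (hΦ.flowJacobian_pos _ _), smul_eq_mul,
    inv_mul_cancel_left₀ (hΦ.flowJacobian_pos s x).ne']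

lemma hasDerivAt_integral_comp_mul (hu : LocallyIntegrable u) (hφ : ContDiff ℝ 1 φ)
    (hφc : HasCompactSupport φ) (s : ℝ) :
    HasDerivAt (fun t => ∫ x, u (Φ t x) * φ x)
      (-∫ x, u x * euclideanDiv (fun y => pushDensity Φ s φ y • Z y) x) s := by
  simpa only [hΦ.integral_comp_mul] using hΦ.hasDerivAt_integral_mul_pushDensity hu hφ hφc s

end IsFlowOf
end FlowIntegral

section Duality

variable {E : Type*} [NormedAddCommGroup E] [NormedSpace ℝ E] [FiniteDimensional ℝ E]
  [MeasureSpace E] [BorelSpace E] [(volume : Measure E).IsAddHaarMeasure] {f g : E → ℝ}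
  {K U : Set E}

open scoped Convolution in
lemma norm_normed_convolution_le_one (ρ : ContDiffBump (0 : E)) (hg : ∀ x, ‖g x‖ ≤ 1) (x : E) :
    ‖(ρ.normed volume ⋆[ContinuousLinearMap.lsmul ℝ ℝ, volume] g) x‖ ≤ 1 := by
  rw [convolution_def, ← ρ.integral_normed (μ := volume)]
  refine norm_integral_le_of_norm_le ρ.integrable_normed (Eventually.of_forall fun t => ?_)
  rw [ContinuousLinearMap.lsmul_apply, norm_smul, Real.norm_of_nonneg (ρ.nonneg_normed t)]
  exact mul_le_of_le_one_right (ρ.nonneg_normed t) (hg _)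

open scoped Convolution in
lemma tsupport_normed_convolution_subset (ρ : ContDiffBump (0 : E)) :
    tsupport (ρ.normed volume ⋆[ContinuousLinearMap.lsmul ℝ ℝ, volume] g)
      ⊆ Metric.cthickening ρ.rOut (Function.support g) := by
  refine closure_minimal ((support_convolution_subset _).trans ?_) Metric.isClosed_cthickening
  rw [ρ.support_normed_eq]
  rintro _ ⟨t, ht, y, hy, rfl⟩
  exact Metric.mem_cthickening_of_dist_le _ y _ _ hy (by simpa using (Metric.mem_ball.1 ht).le)

lemma exists_seq_contDiff_tendsto_ae (hK : IsCompact K) (hgK : Function.support g ⊆ K)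
    (hgm : AEStronglyMeasurable g) (hg : ∀ x, ‖g x‖ ≤ 1) {δ : ℝ} (hδ : 0 < δ) :
    ∃ ψ : ℕ → E → ℝ, (∀ n, ContDiff ℝ 1 (ψ n)) ∧ (∀ n x, ‖ψ n x‖ ≤ 1) ∧
      (∀ n, tsupport (ψ n) ⊆ Metric.cthickening δ K) ∧
      ∀ᵐ x, Tendsto (fun n => ψ n x) atTop (𝓝 (g x)) := by
  have hgi : Integrable g := by
    rw [← integrableOn_iff_integrable_of_support_subset hgK]
    exact Measure.integrableOn_of_bounded hK.measure_lt_top.ne hgm (Eventually.of_forall hg)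
  have hr (n : ℕ) : 0 < δ / (n + 1) := by positivity
  let ρ (n : ℕ) : ContDiffBump (0 : E) := ⟨δ / (n + 1) / 2, δ / (n + 1), half_pos (hr n),
    half_lt_self (hr n)⟩
  refine ⟨fun n => convolution ((ρ n).normed volume) g (ContinuousLinearMap.lsmul ℝ ℝ) volume,
    fun n => ?_, fun n => norm_normed_convolution_le_one (ρ n) hg, fun n => ?_, ?_⟩
  · exact (ρ n).hasCompactSupport_normed.contDiff_convolution_left (n := 1) _
      (ρ n).contDiff_normed hgi.locallyIntegrable
  · refine (tsupport_normed_convolution_subset (ρ n)).trans ?_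
    exact (Metric.cthickening_mono (div_le_self hδ.le (by simp)) _).trans
      (Metric.cthickening_subset_of_subset δ hgK)
  · refine ContDiffBump.ae_convolution_tendsto_right_of_locallyIntegrable (K := 2) ?_
      (Eventually.of_forall fun n => ?_) hgi.locallyIntegrable
    · exact tendsto_const_div_atTop_nhds_zero_nat δ |>.comp (tendsto_add_atTop_nat 1) |>.congr
        fun n => by simp [ρ]
    · exact (mul_div_cancel₀ _ two_ne_zero).ge

lemma setIntegral_norm_le_of_forall_contDiff {C : ℝ} (hf : LocallyIntegrable f) (hU : IsOpen U)
    (hC : ∀ ψ : E → ℝ, ContDiff ℝ 1 ψ → HasCompactSupport ψ → tsupport ψ ⊆ U →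
      (∀ x, ‖ψ x‖ ≤ 1) → ∫ x, f x * ψ x ≤ C) (hK : IsCompact K) (hKU : K ⊆ U) :
    ∫ x in K, ‖f x‖ ≤ C := by
  obtain ⟨δ, hδ, hδU⟩ := hK.exists_cthickening_subset_open hU hKU
  let L := Metric.cthickening δ K
  have hL : IsCompact L := hK.cthickening
  have hfL : IntegrableOn f L := hf.integrableOn_isCompact hL
  have hsign (x : E) : f x * (f x / ‖f x‖) = ‖f x‖ := by
    rw [← mul_div_assoc, Real.norm_eq_abs, ← abs_mul_abs_self, mul_self_div_self]
  obtain ⟨ψ, hψ, hψ1, hψL, hlim⟩ := exists_seq_contDiff_tendsto_ae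
    (g := K.indicator fun x => f x / ‖f x‖) hK support_indicator_subset
    ((hf.aestronglyMeasurable.div₀ hf.aestronglyMeasurable.norm).indicator hK.measurableSet)
    (fun x => (norm_indicator_le_norm_self _ x).trans <| by
      simpa using div_self_le_one |f x|) hδ
  have hψ0 (n : ℕ) (x : E) (hx : x ∉ L) : f x * ψ n x = 0 := by
    rw [image_eq_zero_of_notMem_tsupport fun h => hx (hψL n h), mul_zero]
  have hle (n : ℕ) : ∫ x in L, f x * ψ n x ≤ C := by
    rw [setIntegral_eq_integral_of_forall_compl_eq_zero (hψ0 n)]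
    exact hC _ (hψ n) (hL.of_isClosed_subset (isClosed_tsupport _) (hψL n)) ((hψL n).trans hδU)
      (hψ1 n)
  have htendsto := tendsto_integral_of_dominated_convergence (μ := volume.restrict L)
    (F := fun n x => f x * ψ n x) (fun x => ‖f x‖)
    (fun n => hfL.aestronglyMeasurable.mul (hψ n).continuous.aestronglyMeasurable) hfL.norm
    (fun n => Eventually.of_forall fun x => by
      simpa using mul_le_of_le_one_right (norm_nonneg (f x)) (hψ1 n x))
    ((ae_restrict_of_ae hlim).mono fun x hx => hx.const_mul (f x))
  refine le_of_eq_of_le ?_ (le_of_tendsto' htendsto hle)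
  simp_rw [← Set.indicator_mul_right, hsign]
  rw [setIntegral_indicator hK.measurableSet,
    inter_eq_right.2 (Metric.self_subset_cthickening K)]

lemma setLIntegral_enorm_le_of_forall_contDiff {C : ℝ} (hf : LocallyIntegrable f) (hU : IsOpen U)
    (hC : ∀ ψ : E → ℝ, ContDiff ℝ 1 ψ → HasCompactSupport ψ → tsupport ψ ⊆ U →
      (∀ x, ‖ψ x‖ ≤ 1) → ∫ x, f x * ψ x ≤ C) :
    ∫⁻ x in U, ‖f x‖ₑ ≤ ENNReal.ofReal C := by
  let μ : Measure E := volume.withDensity fun x => ‖f x‖ₑ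
  have hμK {K : Set E} (hK : IsCompact K) : μ K = ENNReal.ofReal (∫ x in K, ‖f x‖) := by
    rw [withDensity_apply _ hK.measurableSet,
      ofReal_integral_norm_eq_lintegral_enorm (hf.integrableOn_isCompact hK)]
  have : IsFiniteMeasureOnCompacts μ := ⟨fun K hK => hμK hK ▸ ENNReal.ofReal_lt_top⟩
  rw [← withDensity_apply _ hU.measurableSet, hU.measure_eq_iSup_isCompact]
  refine iSup₂_le fun K hKU => iSup_le fun hK => (hμK hK).trans_le ?_
  exact ENNReal.ofReal_le_ofReal (setIntegral_norm_le_of_forall_contDiff hf hU hC hK hKU)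

end Duality

section WeakCompactness

open scoped CompactlySupported NNReal

variable {X : Type*} [TopologicalSpace X] [MeasurableSpace X]
  {ι : Type*} {U : Ultrafilter ι} {m : ι → Measure X} {C : ℝ≥0}

lemma exists_tendsto_integral (hm : ∀ k, m k univ ≤ C) (f : C_c(X, ℝ)) :
    ∃ l, Tendsto (fun k => ∫ x, f x ∂(m k)) U (𝓝 l) := by
  obtain ⟨B, hB⟩ := f.continuous.bounded_above_of_compact_support f.hasCompactSupport
  have hbound (k : ι) : ‖∫ x, f x ∂(m k)‖ ≤ max B 0 * C := by
    have : IsFiniteMeasure (m k) := ⟨(hm k).trans_lt ENNReal.coe_lt_top⟩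
    refine (norm_integral_le_of_norm_le_const
      (Eventually.of_forall fun x => (hB x).trans (le_max_left B 0))).trans ?_
    gcongr
    exact ENNReal.toReal_le_coe_of_le_coe (hm k)
  obtain ⟨l, -, hl⟩ := (isCompact_closedBall (0 : ℝ) (max B 0 * C)).ultrafilter_le_nhds'
    (U.map fun k => ∫ x, f x ∂(m k))
    (Eventually.of_forall (f := (U : Filter ι)) fun k => by simpa using hbound k)
  exact ⟨l, hl⟩

variable [BorelSpace X] [T2Space X] [LocallyCompactSpace X] [SigmaCompactSpace X]

lemma rieszMeasure_univ_le (Λ : C_c(X, ℝ) →ₚ[ℝ] ℝ)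
    (hΛ : ∀ f : C_c(X, ℝ), (∀ x, f x ∈ Icc 0 1) → Λ f ≤ C) : RealRMK.rieszMeasure Λ univ ≤ C := by
  have hcover (n : ℕ) : RealRMK.rieszMeasure Λ (compactCovering X n) ≤ C := by
    obtain ⟨f, hf1, -, hfc, hf⟩ := exists_continuous_one_zero_of_isCompact
      (isCompact_compactCovering X n) isClosed_empty (disjoint_empty _)
    refine (RealRMK.rieszMeasure_le_of_eq_one Λ (f := ⟨f, hfc⟩) (fun x => (hf x).1)
      (isCompact_compactCovering X n) hf1).trans ?_
    rw [← ENNReal.ofReal_coe_nnreal]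
    exact ENNReal.ofReal_le_ofReal (hΛ _ hf)
  have hmono : Monotone (compactCovering X) := fun _ _ h => compactCovering_subset X h
  rw [← iUnion_compactCovering, hmono.measure_iUnion]
  exact iSup_le hcover

lemma exists_isFiniteMeasure_tendsto_integral (U : Ultrafilter ι)
    (hm : ∀ k, m k univ ≤ C) :
    ∃ μ : Measure X, IsFiniteMeasure μ ∧ ∀ f : X → ℝ, Continuous f → HasCompactSupport f →
      Tendsto (fun k => ∫ x, f x ∂(m k)) U (𝓝 (∫ x, f x ∂μ)) := by
  have hfin (k : ι) : IsFiniteMeasure (m k) := ⟨(hm k).trans_lt ENNReal.coe_lt_top⟩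
  have hint (f : C_c(X, ℝ)) (k : ι) : Integrable f (m k) :=
    f.continuous.integrable_of_hasCompactSupport f.hasCompactSupport
  choose Λ hΛ using exists_tendsto_integral (U := U) hm
  let Λ' : C_c(X, ℝ) →ₚ[ℝ] ℝ := PositiveLinearMap.mk₀
    { toFun := Λ
      map_add' := fun f g => tendsto_nhds_unique (hΛ (f + g)) <|
        ((hΛ f).add (hΛ g)).congr fun k => by simp [integral_add (hint f k) (hint g k)]
      map_smul' := fun c f => tendsto_nhds_unique (hΛ (c • f)) <|
        ((hΛ f).const_mul c).congr fun k => by simp [integral_const_mul] }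
    fun f hf => ge_of_tendsto' (hΛ f) fun k => integral_nonneg hf
  have hΛ1 (f : C_c(X, ℝ)) (hf : ∀ x, f x ∈ Icc 0 1) : Λ' f ≤ C :=
    le_of_tendsto' (hΛ f) fun k => by
      refine (integral_mono (hint f k) (integrable_const 1) fun x => (hf x).2).trans ?_
      simpa [Measure.real] using ENNReal.toReal_le_coe_of_le_coe (hm k)
  refine ⟨RealRMK.rieszMeasure Λ', ⟨(rieszMeasure_univ_le Λ' hΛ1).trans_lt ENNReal.coe_lt_top⟩,
    fun f hf hfc => ?_⟩
  rw [show ∫ x, f x ∂(RealRMK.rieszMeasure Λ') = Λ ⟨⟨f, hf⟩, hfc⟩ from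
    RealRMK.integral_rieszMeasure Λ' ⟨⟨f, hf⟩, hfc⟩]
  exact hΛ ⟨⟨f, hf⟩, hfc⟩

lemma integral_lsmul_toSignedMeasure {α : Type*} [MeasurableSpace α] (μ : Measure α)
    [IsFiniteMeasure μ] (f : α → ℝ) : ∫ᵛ x, f x ∂•μ.toSignedMeasure = ∫ x, f x ∂μ := by
  have hflip : ContinuousLinearMap.lsmul ℝ ℝ = (ContinuousLinearMap.lsmul ℝ ℝ (E := ℝ)).flip := by
    ext
    simp
  rw [hflip, VectorMeasure.integral_toSignedMeasure]

lemma integral_withDensity_ofReal_sub {α : Type*} [MeasurableSpace α] {μ : Measure α}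
    {f φ : α → ℝ} (hf : AEMeasurable f μ)
    (hpos : Integrable φ (μ.withDensity fun x => ENNReal.ofReal (f x)))
    (hneg : Integrable φ (μ.withDensity fun x => ENNReal.ofReal (-f x))) :
    ∫ x, φ x ∂(μ.withDensity fun x => ENNReal.ofReal (f x))
      - ∫ x, φ x ∂(μ.withDensity fun x => ENNReal.ofReal (-f x)) = ∫ x, f x * φ x ∂μ := by
  have hf' : AEMeasurable (fun x => ENNReal.ofReal (-f x)) μ := hf.neg.ennreal_ofReal
  rw [integrable_withDensity_iff_integrable_smul₀' hf.ennreal_ofReal (by simp)] at hpos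
  rw [integrable_withDensity_iff_integrable_smul₀' hf' (by simp)] at hneg
  rw [integral_withDensity_eq_integral_toReal_smul₀ hf.ennreal_ofReal (by simp),
    integral_withDensity_eq_integral_toReal_smul₀ hf' (by simp),
    ← integral_sub hpos hneg]
  refine integral_congr_ae (Eventually.of_forall fun x => ?_)
  simp only [smul_eq_mul, ← sub_mul, ENNReal.toReal_ofReal',
    max_zero_sub_max_neg_zero_eq_self]

lemma exists_signedMeasure_tendsto_integral_mul {μ : Measure X} {f : ι → X → ℝ} (U : Ultrafilter ι)
    (hf : ∀ k, AEMeasurable (f k) μ) (hC : ∀ k, ∫⁻ x, ‖f k x‖ₑ ∂μ ≤ C) :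
    ∃ D : SignedMeasure X, ∀ φ : X → ℝ, Continuous φ → HasCompactSupport φ →
      Tendsto (fun k => ∫ x, f k x * φ x ∂μ) U (𝓝 (∫ᵛ x, φ x ∂•D)) := by
  have hmass (g : X → ℝ) (hg : ∫⁻ x, ‖g x‖ₑ ∂μ ≤ C) :
      μ.withDensity (fun x => ENNReal.ofReal (g x)) univ ≤ C := by
    rw [withDensity_apply _ MeasurableSet.univ, setLIntegral_univ]
    exact (lintegral_mono fun x => Real.ofReal_le_enorm (g x)).trans hg
  have hpos (k : ι) := hmass (f k) (hC k)
  have hneg (k : ι) := hmass (fun x => -f k x) (by simpa using hC k)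
  obtain ⟨ν, hν, hνlim⟩ := exists_isFiniteMeasure_tendsto_integral U hpos
  obtain ⟨ν', hν', hνlim'⟩ := exists_isFiniteMeasure_tendsto_integral U hneg
  refine ⟨ν.toSignedMeasure - ν'.toSignedMeasure, fun φ hφ hφc => ?_⟩
  have hint (T : Measure X) [IsFiniteMeasure T] : Integrable φ T :=
    hφ.integrable_of_hasCompactSupport hφc
  rw [VectorMeasure.integral_sub_vectorMeasure
      (by simpa [VectorMeasure.Integrable] using hint ν)
      (by simpa [VectorMeasure.Integrable] using hint ν'),
    integral_lsmul_toSignedMeasure, integral_lsmul_toSignedMeasure]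
  refine ((hνlim φ hφ hφc).sub (hνlim' φ hφ hφc)).congr fun k => ?_
  have : IsFiniteMeasure (μ.withDensity fun x => ENNReal.ofReal (f k x)) :=
    ⟨(hpos k).trans_lt ENNReal.coe_lt_top⟩
  have : IsFiniteMeasure (μ.withDensity fun x => ENNReal.ofReal (-f k x)) :=
    ⟨(hneg k).trans_lt ENNReal.coe_lt_top⟩
  exact integral_withDensity_ofReal_sub (hf k) (hint _) (hint _)

end WeakCompactness

section DifferenceQuotients

open scoped NNReal

section FlowDomain

variable {X : Type*} [TopologicalSpace X] {Φ : Flow ℝ X} {Ω K : Set X}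

/-- The points whose orbit under `Φ` stays in `Ω` during the whole time interval `[0, h]`. -/
def flowDomain (Φ : Flow ℝ X) (Ω : Set X) (h : ℝ) : Set X := {x | ∀ s ∈ Icc 0 h, Φ s x ∈ Ω}

lemma isOpen_flowDomain (hΩ : IsOpen Ω) (h : ℝ) : IsOpen (flowDomain Φ Ω h) := by
  refine isOpen_iff_mem_nhds.2 fun x hx => ?_
  obtain ⟨S, V, -, hV, hS, hxV, hSV⟩ := generalized_tube_lemma (isCompact_Icc (a := 0) (b := h))
    (isCompact_singleton (x := x)) (hΩ.preimage Φ.cont') (by rintro ⟨s, y⟩ ⟨hs, rfl⟩; exact hx s hs)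
  exact mem_of_superset (hV.mem_nhds (hxV rfl)) fun y hy s hs =>
    hSV (show (s, y) ∈ S ×ˢ V from ⟨hS hs, hy⟩)

lemma eventually_subset_flowDomain (hΩ : IsOpen Ω) (hK : IsCompact K) (hKΩ : K ⊆ Ω) :
    ∀ᶠ h in 𝓝 0, K ⊆ flowDomain Φ Ω h := by
  obtain ⟨S, V, hS, -, h0S, hKV, hSV⟩ := generalized_tube_lemma (isCompact_singleton (x := (0 : ℝ)))
    hK (hΩ.preimage Φ.cont') (by rintro ⟨s, y⟩ ⟨rfl, hy⟩; simpa using hKΩ hy)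
  obtain ⟨δ, hδ, hball⟩ := Metric.isOpen_iff.1 hS 0 (h0S rfl)
  filter_upwards [Iio_mem_nhds hδ] with h hh x hx s hs
  refine hSV (show (s, x) ∈ S ×ˢ V from ⟨hball ?_, hKV hx⟩)
  rw [mem_ball_zero_iff, Real.norm_of_nonneg hs.1]
  exact hs.2.trans_lt hh

end FlowDomain

/-- The difference quotients `h⁻¹ (u ∘ Φ h - u)` of `u` along the flow `Φ` are bounded in `L¹`,
uniformly for `0 < h ≤ 1`, each on the set where it only involves orbits inside `Ω`. -/
def HasBoundedDifferenceQuotients {X : Type*} [TopologicalSpace X] [MeasureSpace X] (Φ : Flow ℝ X)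
    (Ω : Set X) (u : X → ℝ) : Prop :=
  ∃ C : ℝ≥0, ∀ h ∈ Ioc (0 : ℝ) 1,
    ∫⁻ x in flowDomain Φ Ω h, ‖u (Φ h x) - u x‖ₑ ≤ C * ENNReal.ofReal h

/-- The difference quotient of `u` along the flow `Φ`, cut off outside the set where it only
involves orbits inside `Ω`. -/
noncomputable def differenceQuotient {X : Type*} [TopologicalSpace X] (Φ : Flow ℝ X) (Ω : Set X)
    (u : X → ℝ) (h : ℝ) : X → ℝ :=
  (flowDomain Φ Ω h).indicator fun x => h⁻¹ * (u (Φ h x) - u x)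

lemma lintegral_enorm_differenceQuotient {X : Type*} [TopologicalSpace X] [MeasureSpace X]
    [OpensMeasurableSpace X] {Φ : Flow ℝ X} {Ω : Set X} {u : X → ℝ} {h : ℝ} (hΩ : IsOpen Ω)
    (hh : 0 < h) : ∫⁻ x, ‖differenceQuotient Φ Ω u h x‖ₑ
      = (∫⁻ x in flowDomain Φ Ω h, ‖u (Φ h x) - u x‖ₑ) / ENNReal.ofReal h := by
  simp_rw [differenceQuotient, enorm_indicator_eq_indicator_enorm, enorm_mul]
  rw [lintegral_indicator (isOpen_flowDomain hΩ _).measurableSet,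
    lintegral_const_mul' _ _ enorm_ne_top, Real.enorm_of_nonneg (inv_nonneg.2 hh.le),
    ENNReal.ofReal_inv_of_pos hh, mul_comm, ← div_eq_mul_inv]

variable {E : Type*} [NormedAddCommGroup E] [NormedSpace ℝ E] [MeasureSpace E]
  {Φ : Flow ℝ E} {Z : E → E} {Ω : Set E} {u φ : E → ℝ}

lemma setIntegral_mul_euclideanDiv_smul (hφΩ : tsupport φ ⊆ Ω) :
    ∫ x in Ω, u x * euclideanDiv (fun y => φ y • Z y) x
      = ∫ x, u x * euclideanDiv (fun y => φ y • Z y) x :=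
  setIntegral_eq_integral_of_forall_compl_eq_zero fun x hx => by
    rw [image_eq_zero_of_notMem_tsupport fun h => hx (hφΩ (tsupport_smul_subset_left φ Z
      (tsupport_euclideanDiv_subset h))), mul_zero]

variable [FiniteDimensional ℝ E] [BorelSpace E] [(volume : Measure E).IsAddHaarMeasure]

namespace IsFlowOf

variable (hΦ : IsFlowOf Φ Z)
include hΦ

lemma integral_comp_sub_mul (hu : LocallyIntegrable u) (hφ : Continuous φ)
    (hφc : HasCompactSupport φ) (h : ℝ) :
    ∫ x, (u (Φ h x) - u x) * φ x = (∫ x, u (Φ h x) * φ x) - ∫ x, u (Φ 0 x) * φ x := by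
  have hint {v : E → ℝ} (hv : LocallyIntegrable v) : Integrable fun x => v x * φ x := by
    simpa only [smul_eq_mul, mul_comm] using hv.integrable_smul_left_of_hasCompactSupport hφ hφc
  simp_rw [Φ.map_zero_apply, sub_mul]
  exact integral_sub (hint (hΦ.locallyIntegrable_comp hu h)) (hint hu)

lemma tendsto_integral_differenceQuotient_mul (hu : LocallyIntegrable u) (hΩ : IsOpen Ω)
    (hφ : ContDiff ℝ 1 φ) (hφc : HasCompactSupport φ) (hφΩ : tsupport φ ⊆ Ω) :
    Tendsto (fun h => ∫ x, differenceQuotient Φ Ω u h x * φ x) (𝓝[>] 0)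
      (𝓝 (-∫ x in Ω, u x * euclideanDiv (fun y => φ y • Z y) x)) := by
  have hderiv := hΦ.hasDerivAt_integral_comp_mul hu hφ hφc 0
  simp_rw [pushDensity_zero] at hderiv
  rw [setIntegral_mul_euclideanDiv_smul hφΩ]
  refine (hderiv.tendsto_slope_zero.mono_left (nhdsGT_le_nhdsNE 0)).congr' ?_
  filter_upwards [nhdsWithin_le_nhds (eventually_subset_flowDomain (Φ := Φ) hΩ hφc hφΩ)] with h hh
  have hq (x : E) :
      differenceQuotient Φ Ω u h x * φ x = h⁻¹ * ((u (Φ h x) - u x) * φ x) := by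
    by_cases hx : x ∈ flowDomain Φ Ω h
    · simp only [differenceQuotient, indicator_of_mem hx, mul_assoc]
    · simp [image_eq_zero_of_notMem_tsupport fun h => hx (hh h)]
  simp_rw [hq, integral_const_mul, hΦ.integral_comp_sub_mul hu hφ.continuous hφc, zero_add,
    smul_eq_mul]

lemma aemeasurable_differenceQuotient (hu : LocallyIntegrable u) (hΩ : IsOpen Ω) (h : ℝ) :
    AEMeasurable (differenceQuotient Φ Ω u h) :=
  (((hΦ.locallyIntegrable_comp hu h).sub hu).aestronglyMeasurable.aemeasurable.const_mul
    _).indicator (isOpen_flowDomain hΩ h).measurableSet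

lemma hasFiniteFieldVariation_of_hasBoundedDifferenceQuotients (hu : LocallyIntegrable u)
    (hΩ : IsOpen Ω) (hquot : HasBoundedDifferenceQuotients Φ Ω u) :
    HasFiniteFieldVariation Z Ω u := by
  obtain ⟨C, hC⟩ := hquot
  let h (k : ℕ) : ℝ := 1 / (k + 1)
  have hpos (k : ℕ) : 0 < h k := Nat.one_div_pos_of_nat
  have hle (k : ℕ) : h k ≤ 1 := div_le_one_of_le₀ (by simp) (by positivity)
  have hmass (k : ℕ) : ∫⁻ x, ‖differenceQuotient Φ Ω u (h k) x‖ₑ ≤ C := by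
    rw [lintegral_enorm_differenceQuotient hΩ (hpos k)]
    exact ENNReal.div_le_of_le_mul (hC _ ⟨hpos k, hle k⟩)
  obtain ⟨D, hD⟩ := exists_signedMeasure_tendsto_integral_mul (hyperfilter ℕ)
    (fun k => hΦ.aemeasurable_differenceQuotient hu hΩ (h k)) hmass
  have hh : Tendsto h (hyperfilter ℕ) (𝓝[>] 0) := tendsto_nhdsWithin_iff.2
    ⟨tendsto_one_div_add_atTop_nhds_zero_nat.mono_left Nat.hyperfilter_le_atTop,
      Eventually.of_forall hpos⟩
  exact ⟨D, fun φ hφ hφc hφΩ => tendsto_nhds_unique (hD φ hφ.continuous hφc)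
    ((hΦ.tendsto_integral_differenceQuotient_mul hu hΩ hφ hφc hφΩ).comp hh)⟩

lemma hasBoundedDifferenceQuotients_of_hasFiniteFieldVariation {M : ℝ≥0}
    (hM : ∀ s ∈ Icc (0 : ℝ) 1, ∀ y ∈ Ω, flowJacobian Φ (-s) y ≤ M) (hu : LocallyIntegrable u)
    (hΩ : IsOpen Ω) (hvar : HasFiniteFieldVariation Z Ω u) :
    HasBoundedDifferenceQuotients Φ Ω u := by
  obtain ⟨D, hD⟩ := hvar
  let V : ℝ≥0 := ⟨D.variation.real univ, measureReal_nonneg⟩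
  refine ⟨M * V, fun h hh => ?_⟩
  rw [← ENNReal.ofReal_coe_nnreal, ← ENNReal.ofReal_mul (NNReal.coe_nonneg _)]
  refine setLIntegral_enorm_le_of_forall_contDiff ((hΦ.locallyIntegrable_comp hu h).sub hu)
    (isOpen_flowDomain hΩ h) fun φ hφ hφc hφΩ hφ1 => ?_
  have himage {s : ℝ} (hs : s ∈ Icc 0 h) : Φ s '' tsupport φ ⊆ Ω :=
    image_subset_iff.2 fun x hx => hφΩ hx s hs
  have hderiv {s : ℝ} (hs : s ∈ Icc 0 h) :
      HasDerivAt (fun t => ∫ x, u (Φ t x) * φ x) (∫ᵛ x, pushDensity Φ s φ x ∂•D) s := by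
    have hsub := (tsupport_pushDensity_subset hφc s).trans (himage hs)
    rw [hD _ (hΦ.contDiff_pushDensity hφ s) (hasCompactSupport_pushDensity hφc s) hsub,
      setIntegral_mul_euclideanDiv_smul hsub]
    exact hΦ.hasDerivAt_integral_comp_mul hu hφ hφc s
  have hbound {s : ℝ} (hs : s ∈ Icc 0 h) : ‖∫ᵛ x, pushDensity Φ s φ x ∂•D‖ ≤ M * V := by
    refine (VectorMeasure.norm_integral_le_of_norm_le_const (Eventually.of_forall <|
      hΦ.norm_pushDensity_le (hM s (Icc_subset_Icc_right hh.2 hs)) hφ1 (himage hs))).trans ?_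
    exact mul_le_mul_of_nonneg_right
      (mul_le_of_le_one_right M.2 ContinuousLinearMap.opNorm_lsmul_le) measureReal_nonneg
  calc ∫ x, (u (Φ h x) - u x) * φ x
      ≤ ‖(∫ x, u (Φ h x) * φ x) - ∫ x, u (Φ 0 x) * φ x‖ := by
        rw [hΦ.integral_comp_sub_mul hu hφ.continuous hφc]
        exact Real.le_norm_self _
    _ ≤ (M * V) * (h - 0) := norm_image_sub_le_of_norm_deriv_le_segment'
        (fun s hs => (hderiv hs).hasDerivWithinAt) (fun s hs => hbound (Ico_subset_Icc_self hs)) h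
        (right_mem_Icc.2 hh.1.le)
    _ = _ := by rw [sub_zero, NNReal.coe_mul]

end IsFlowOf

end DifferenceQuotients

section Subgraph

open scoped NNReal

lemma lintegral_enorm_indicator_Iio_sub (a b : ℝ) :
    ∫⁻ t, ‖(Iio a).indicator (fun _ => (1 : ℝ)) t - (Iio b).indicator (fun _ => 1) t‖ₑ
      = ‖a - b‖ₑ := by
  have hIco (t : ℝ) : ‖(Iio a).indicator (fun _ => (1 : ℝ)) t - (Iio b).indicator (fun _ => 1) t‖ₑ
      = (Ico (min a b) (max a b)).indicator 1 t := by
    by_cases ha : t < a <;> by_cases hb : t < b <;>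
      simp [indicator, ha, hb, le_of_not_gt]
  simp_rw [hIco]
  rw [lintegral_indicator_one measurableSet_Ico, Real.volume_Ico, max_sub_min_eq_abs',
    ← Real.enorm_eq_ofReal_abs]

section DriftFlow

variable {X : Type*} [TopologicalSpace X]

/-- The flow on `X × ℝ` which moves the first factor by `Φ` and translates the second one with
constant speed `c`. -/
def driftFlow (Φ : Flow ℝ X) (c : ℝ) : Flow ℝ (X × ℝ) where
  toFun s p := (Φ s p.1, p.2 + s * c)
  cont' := (Φ.continuous continuous_fst continuous_snd.fst).prodMk (by fun_prop)
  map_add' s t p := by rw [Φ.map_add, add_comm s, add_mul, add_assoc]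
  map_zero' p := by simp

lemma driftFlow_apply (Φ : Flow ℝ X) (c s : ℝ) (p : X × ℝ) :
    driftFlow Φ c s p = (Φ s p.1, p.2 + s * c) := rfl

lemma flowDomain_driftFlow (Φ : Flow ℝ X) (c : ℝ) (Ω : Set X) (h : ℝ) :
    flowDomain (driftFlow Φ c) (Ω ×ˢ univ) h = flowDomain Φ Ω h ×ˢ univ := by
  ext p
  simp [flowDomain, driftFlow_apply]

lemma flowDomain_subset {Φ : Flow ℝ X} {Ω : Set X} {h : ℝ} (hh : 0 ≤ h) :
    flowDomain Φ Ω h ⊆ Ω := fun x hx => by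
  simpa using hx 0 (left_mem_Icc.2 hh)

end DriftFlow

section IsFlowOf

variable {E : Type*} [NormedAddCommGroup E] [NormedSpace ℝ E] {Φ : Flow ℝ E} {Z : E → E}

lemma IsFlowOf.drift (hΦ : IsFlowOf Φ Z) (c : ℝ) :
    IsFlowOf (driftFlow Φ c) fun p => (Z p.1, c) where
  contDiff := (hΦ.contDiff.comp (contDiff_fst.prodMk (contDiff_fst.comp contDiff_snd))).prodMk
    ((contDiff_snd.comp contDiff_snd).add (contDiff_fst.mul contDiff_const))
  hasDerivAt_zero p := (hΦ.hasDerivAt_zero p.1).prodMk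
    ((hasDerivAt_mul_const c).const_add p.2)

lemma IsFlowOf.flowJacobian_driftFlow [FiniteDimensional ℝ E] (hΦ : IsFlowOf Φ Z) (c s : ℝ)
    (p : E × ℝ) :
    flowJacobian (driftFlow Φ c) s p = flowJacobian Φ s p.1 := by
  have hderiv : HasFDerivAt (driftFlow Φ c s)
      ((fderiv ℝ (Φ s) p.1).prodMap (ContinuousLinearMap.id ℝ ℝ)) p :=
    (hΦ.differentiableAt s p.1).hasFDerivAt.prodMap p ((hasFDerivAt_id p.2).add_const _)
  rw [flowJacobian, hderiv.fderiv, flowJacobian, ContinuousLinearMap.det,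
    ContinuousLinearMap.coe_prodMap, LinearMap.det_prodMap]
  simp [ContinuousLinearMap.det]

lemma IsFlowOf.exists_flowJacobian_le [FiniteDimensional ℝ E] (hΦ : IsFlowOf Φ Z) {Ω : Set E}
    (hΩ : Bornology.IsBounded Ω) :
    ∃ M : ℝ≥0, ∀ s ∈ Icc (0 : ℝ) 1, ∀ y ∈ Ω, flowJacobian Φ (-s) y ≤ M := by
  have hcont : Continuous fun p : ℝ × E => flowJacobian Φ (-p.1) p.2 :=
    hΦ.contDiff_flowJacobian.continuous.comp (f := fun p : ℝ × E => (-p.1, p.2)) (by fun_prop)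
  obtain ⟨M, hM⟩ := ((isCompact_Icc (a := (0 : ℝ)) (b := 1)).prod
    hΩ.isCompact_closure).bddAbove_image hcont.continuousOn
  exact ⟨M.toNNReal, fun s hs y hy =>
    (hM ⟨(s, y), ⟨hs, subset_closure hy⟩, rfl⟩).trans (Real.le_coe_toNNReal M)⟩

end IsFlowOf

section LayerCake

variable {X : Type*} [MeasureSpace X] {u v : X → ℝ} {Ω : Set X}

lemma measurableSet_subgraphOn_univ (hv : Measurable v) : MeasurableSet (subgraphOn univ v) := by
  simp only [subgraphOn, mem_univ, true_and]
  exact measurableSet_lt measurable_snd (hv.comp measurable_fst)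

lemma exists_forall_setLIntegral_enorm_sub_mul_le {W : ℝ → Set X} {f : ℝ → X → ℝ}
    (hΩ : volume Ω ≠ ⊤) (hW : ∀ h ∈ Ioc (0 : ℝ) 1, W h ⊆ Ω) (c : ℝ)
    (hf : ∃ C : ℝ≥0, ∀ h ∈ Ioc (0 : ℝ) 1, ∫⁻ x in W h, ‖f h x‖ₑ ≤ C * ENNReal.ofReal h) :
    ∃ C : ℝ≥0, ∀ h ∈ Ioc (0 : ℝ) 1, ∫⁻ x in W h, ‖f h x - h * c‖ₑ ≤ C * ENNReal.ofReal h := by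
  obtain ⟨C, hC⟩ := hf
  refine ⟨C + ‖c‖₊ * (volume Ω).toNNReal, fun h hh => ?_⟩
  calc ∫⁻ x in W h, ‖f h x - h * c‖ₑ
      ≤ ∫⁻ x in W h, (‖f h x‖ₑ + ‖h * c‖ₑ) := lintegral_mono fun x => enorm_sub_le
    _ = (∫⁻ x in W h, ‖f h x‖ₑ) + ‖h * c‖ₑ * volume (W h) := by
        rw [lintegral_add_right _ measurable_const, setLIntegral_const]
    _ ≤ C * ENNReal.ofReal h + ‖h * c‖ₑ * volume Ω := by
        gcongr
        exacts [hC h hh, hW h hh]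
    _ = _ := by
        rw [enorm_mul, Real.enorm_of_nonneg hh.1.le, ENNReal.coe_add, ENNReal.coe_mul,
          ENNReal.coe_toNNReal hΩ, add_mul, enorm_eq_nnnorm]
        ring

lemma indicator_subgraphOn_ae_eq [SFinite (volume : Measure X)] (hΩ : MeasurableSet Ω)
    (huv : u =ᵐ[volume.restrict Ω] v) :
    (subgraphOn Ω u).indicator (fun _ => (1 : ℝ))
      =ᵐ[volume.restrict (Ω ×ˢ univ)] (subgraphOn univ v).indicator fun _ => 1 := by
  have hfst : ∀ᵐ p : X × ℝ ∂(volume.restrict (Ω ×ˢ univ)), u p.1 = v p.1 := by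
    rw [Measure.volume_eq_prod, ← Measure.prod_restrict]
    exact Measure.quasiMeasurePreserving_fst.ae huv
  filter_upwards [hfst, ae_restrict_mem (hΩ.prod MeasurableSet.univ)] with p hp hpΩ
  simp [indicator, subgraphOn, hp, hpΩ.1]

lemma exists_measurable_representative (hΩ : MeasurableSet Ω) (hu : IntegrableOn u Ω) :
    ∃ v : X → ℝ, Measurable v ∧ Integrable v ∧ u =ᵐ[volume.restrict Ω] v := by
  have hae := hu.aestronglyMeasurable.ae_eq_mk
  refine ⟨Ω.indicator (hu.aestronglyMeasurable.mk u),
    hu.aestronglyMeasurable.stronglyMeasurable_mk.measurable.indicator hΩ,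
    (integrable_indicator_iff hΩ).2 (hu.congr hae), hae.trans (indicator_ae_eq_restrict hΩ).symm⟩

variable [TopologicalSpace X]

section LocallyIntegrable

variable [IsLocallyFiniteMeasure (volume : Measure X)]

lemma locallyIntegrable_indicator_subgraphOn_univ (hv : Measurable v) :
    LocallyIntegrable ((subgraphOn univ v).indicator fun _ => (1 : ℝ)) :=
  (locallyIntegrable_const 1).indicator (measurableSet_subgraphOn_univ hv)

lemma locallyIntegrableOn_indicator_subgraphOn [OpensMeasurableSpace X]
    [SFinite (volume : Measure X)] (hΩ : MeasurableSet Ω) (hu : IntegrableOn u Ω) :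
    LocallyIntegrableOn ((subgraphOn Ω u).indicator fun _ => (1 : ℝ)) (Ω ×ˢ univ) := by
  obtain ⟨v, hv, -, huv⟩ := exists_measurable_representative hΩ hu
  intro p _
  obtain ⟨t, ht, hint⟩ := (locallyIntegrable_indicator_subgraphOn_univ hv) p
  refine ⟨t ∩ Ω ×ˢ univ, inter_mem (mem_nhdsWithin_of_mem_nhds ht) self_mem_nhdsWithin, ?_⟩
  exact (hint.mono_set inter_subset_left).congr (ae_mono
    (Measure.restrict_mono inter_subset_right le_rfl) (indicator_subgraphOn_ae_eq hΩ huv).symm)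

end LocallyIntegrable

variable [BorelSpace X]

lemma setLIntegral_enorm_subgraph_driftFlow_sub [SFinite (volume : Measure X)] {Φ : Flow ℝ X}
    (hv : Measurable v) (W : Set X) (c h : ℝ) :
    ∫⁻ p in W ×ˢ univ, ‖(subgraphOn univ v).indicator (fun _ => (1 : ℝ)) (driftFlow Φ c h p)
        - (subgraphOn univ v).indicator (fun _ => 1) p‖ₑ
      = ∫⁻ x in W, ‖v (Φ h x) - v x - h * c‖ₑ := by
  have hslice (x : X) (t : ℝ) :
      ‖(subgraphOn univ v).indicator (fun _ => (1 : ℝ)) (driftFlow Φ c h (x, t))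
        - (subgraphOn univ v).indicator (fun _ => 1) (x, t)‖ₑ
      = ‖(Iio (v (Φ h x) - h * c)).indicator (fun _ => (1 : ℝ)) t
        - (Iio (v x)).indicator (fun _ => 1) t‖ₑ := by
    simp [indicator, subgraphOn, driftFlow_apply, lt_sub_iff_add_lt]
  have hχ : Measurable ((subgraphOn univ v).indicator fun _ => (1 : ℝ)) :=
    measurable_const.indicator (measurableSet_subgraphOn_univ hv)
  have hΦ : Measurable (driftFlow Φ c h) :=
    ((Φ.continuous_toFun h).measurable.comp measurable_fst).prodMk
      (measurable_snd.add_const _)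
  rw [Measure.volume_eq_prod,
    setLIntegral_prod _ (by exact ((hχ.comp hΦ).sub hχ).enorm.aemeasurable)]
  simp_rw [hslice, Measure.restrict_univ, lintegral_enorm_indicator_Iio_sub, sub_right_comm]

lemma hasBoundedDifferenceQuotients_subgraph_iff [SFinite (volume : Measure X)] {Φ : Flow ℝ X}
    (hΩ : volume Ω ≠ ⊤) (hv : Measurable v) (c : ℝ) :
    HasBoundedDifferenceQuotients (driftFlow Φ c) (Ω ×ˢ univ)
        ((subgraphOn univ v).indicator fun _ => (1 : ℝ)) ↔
      HasBoundedDifferenceQuotients Φ Ω v := by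
  simp only [HasBoundedDifferenceQuotients, flowDomain_driftFlow,
    setLIntegral_enorm_subgraph_driftFlow_sub hv]
  have hW : ∀ h ∈ Ioc (0 : ℝ) 1, flowDomain Φ Ω h ⊆ Ω := fun h hh => flowDomain_subset hh.1.le
  refine ⟨fun hbdd => ?_, exists_forall_setLIntegral_enorm_sub_mul_le hΩ hW c⟩
  simpa using exists_forall_setLIntegral_enorm_sub_mul_le hΩ hW (-c) hbdd

end LayerCake

section Variation

variable {E : Type*} [NormedAddCommGroup E] [NormedSpace ℝ E] [FiniteDimensional ℝ E]
  [MeasureSpace E] [BorelSpace E] [(volume : Measure E).IsAddHaarMeasure] {Φ : Flow ℝ E}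
  {Z : E → E} {Ω : Set E} {u v : E → ℝ}

lemma IsFlowOf.hasFiniteFieldVariation_iff (hΦ : IsFlowOf Φ Z) {M : ℝ≥0}
    (hM : ∀ s ∈ Icc (0 : ℝ) 1, ∀ y ∈ Ω, flowJacobian Φ (-s) y ≤ M) (hu : LocallyIntegrable u)
    (hΩ : IsOpen Ω) :
    HasFiniteFieldVariation Z Ω u ↔ HasBoundedDifferenceQuotients Φ Ω u :=
  ⟨hΦ.hasBoundedDifferenceQuotients_of_hasFiniteFieldVariation hM hu hΩ,
    hΦ.hasFiniteFieldVariation_of_hasBoundedDifferenceQuotients hu hΩ⟩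

lemma IsFlowOf.hasFiniteFieldVariation_subgraphOn_iff (hΦ : IsFlowOf Φ Z) (hΩ : IsOpen Ω)
    (hΩb : Bornology.IsBounded Ω) (hu : IntegrableOn u Ω) (c : ℝ) :
    HasFiniteFieldVariation (fun p : E × ℝ => (Z p.1, c)) (Ω ×ˢ univ)
        ((subgraphOn Ω u).indicator fun _ => (1 : ℝ)) ↔
      HasFiniteFieldVariation Z Ω u := by
  obtain ⟨v, hv, hvint, huv⟩ := exists_measurable_representative hΩ.measurableSet hu
  have hχ := indicator_subgraphOn_ae_eq hΩ.measurableSet huv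
  obtain ⟨M, hM⟩ := hΦ.exists_flowJacobian_le hΩb
  have hM' : ∀ s ∈ Icc (0 : ℝ) 1, ∀ p ∈ Ω ×ˢ (univ : Set ℝ),
      flowJacobian (driftFlow Φ c) (-s) p ≤ M := fun s hs p hp => by
    rw [hΦ.flowJacobian_driftFlow]
    exact hM s hs p.1 hp.1
  have : (volume : Measure (E × ℝ)).IsAddHaarMeasure := Measure.prod.instIsAddHaarMeasure _ _
  calc HasFiniteFieldVariation (fun p : E × ℝ => (Z p.1, c)) (Ω ×ˢ univ)
        ((subgraphOn Ω u).indicator fun _ => (1 : ℝ))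
      ↔ HasFiniteFieldVariation (fun p : E × ℝ => (Z p.1, c)) (Ω ×ˢ univ)
        ((subgraphOn univ v).indicator fun _ => (1 : ℝ)) :=
        ⟨(·.congr_ae hχ), (·.congr_ae hχ.symm)⟩
    _ ↔ HasBoundedDifferenceQuotients (driftFlow Φ c) (Ω ×ˢ univ)
        ((subgraphOn univ v).indicator fun _ => (1 : ℝ)) :=
        (hΦ.drift c).hasFiniteFieldVariation_iff hM'
          (locallyIntegrable_indicator_subgraphOn_univ hv) (hΩ.prod isOpen_univ)
    _ ↔ HasBoundedDifferenceQuotients Φ Ω v :=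
        hasBoundedDifferenceQuotients_subgraph_iff hΩb.measure_lt_top.ne hv c
    _ ↔ HasFiniteFieldVariation Z Ω v :=
        (hΦ.hasFiniteFieldVariation_iff hM hvint.locallyIntegrable hΩ).symm
    _ ↔ HasFiniteFieldVariation Z Ω u := ⟨(·.congr_ae huv.symm), (·.congr_ae huv)⟩

end Variation

end Subgraph

namespace CarnotGroup

variable {E : Type*} [NormedAddCommGroup E] [NormedSpace ℝ E] [FiniteDimensional ℝ E]
  (G : CarnotGroup E)

lemma contDiff_field (v : E) : ContDiff ℝ 1 (G.field v) :=
  (contDiff_leftInvariantField G.contDiff_mul v).of_le (by norm_cast)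

lemma field_add (v w : E) : G.field (v + w) = fun x => G.field v x + G.field w x := by
  ext x
  simp [field, leftInvariantField]

lemma field_smul (c : ℝ) (v : E) : G.field (c • v) = fun x => c • G.field v x := by
  ext x
  simp [field, leftInvariantField]

lemma prodReal_field (w : E × ℝ) : G.prodReal.field w = fun p => (G.field w.1 p.1, w.2) :=
  funext (G.leftInvariantField_prodRealMul w)

lemma prodReal_layer_one : G.prodReal.layer 1 = (G.layer 1).prod ⊤ := by
  change G.prodRealLayer 1 = _
  rw [prodRealLayer, if_pos rfl]

/-- The flow of the left-invariant vector field `G.field v`: right multiplication by the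
one-parameter subgroup `s ↦ exp (s v)`, which is `s ↦ s • v` in exponential coordinates. -/
def flow (v : E) : Flow ℝ E where
  toFun s x := G.mul x (s • v)
  cont' := G.contDiff_mul.continuous.comp
    (f := fun p : ℝ × E => (p.2, p.1 • v)) (by fun_prop)
  map_add' s t x := by rw [G.mul_assoc, G.smul_mul_smul, add_comm]
  map_zero' x := by rw [zero_smul, G.mul_zero]

lemma isFlowOf_flow (v : E) : IsFlowOf (G.flow v) (G.field v) where
  contDiff := (G.contDiff_mul.of_le (by norm_cast)).comp
    (f := fun p : ℝ × E => (p.2, p.1 • v)) (by fun_prop)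
  hasDerivAt_zero x := by
    have hmul : HasFDerivAt (G.mul x) (fderiv ℝ (G.mul x) 0) ((0 : ℝ) • v) := by
      rw [zero_smul]
      exact ((G.contDiff_mul.comp (f := fun y : E => (x, y)) (by fun_prop)).differentiable
        (by simp) 0).hasFDerivAt
    exact (hmul.comp_hasDerivAt (f := fun s : ℝ => s • v) 0
      ((hasDerivAt_id (0 : ℝ)).smul_const v)).congr_deriv (by rw [one_smul]; rfl)

variable [MeasureSpace E] [BorelSpace E] {Ω : Set E} {u : E → ℝ}

lemma hasFiniteHVariation_iff_forall_mem_layer_one {ι : Type*} [Fintype ι]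
    (X : Module.Basis ι ℝ (G.layer 1)) (hu : LocallyIntegrableOn u Ω) :
    HasFiniteHVariation (fun i => G.field (X i : E)) Ω u ↔
      ∀ v ∈ G.layer 1, HasFiniteFieldVariation (G.field v) Ω u := by
  rw [hasFiniteHVariation_basis_iff X (Z := fun v => G.field v) hu
    (fun v => G.contDiff_field v) (fun v w => G.field_add v w) (fun c v => G.field_smul c v),
    Subtype.forall]

lemma hasFiniteFieldVariation_prodReal_field_iff [(volume : Measure E).IsAddHaarMeasure]
    (hΩ : IsOpen Ω) (hΩb : Bornology.IsBounded Ω) (hu : IntegrableOn u Ω) (w : E × ℝ) :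
    HasFiniteFieldVariation (G.prodReal.field w) (Ω ×ˢ univ)
        ((subgraphOn Ω u).indicator fun _ => (1 : ℝ)) ↔
      HasFiniteFieldVariation (G.field w.1) Ω u := by
  rw [prodReal_field]
  exact (G.isFlowOf_flow w.1).hasFiniteFieldVariation_subgraphOn_iff hΩ hΩb hu w.2

end CarnotGroup

theorem theorem1p3_general {E : Type*} [NormedAddCommGroup E] [NormedSpace ℝ E]
    [FiniteDimensional ℝ E] [MeasureSpace E] [BorelSpace E] [(volume : Measure E).IsAddHaarMeasure]
    {ι κ : Type*} [Fintype ι] [Fintype κ] (G : CarnotGroup E) (X : Module.Basis ι ℝ (G.layer 1))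
    (Y : Module.Basis κ ℝ (G.prodReal.layer 1)) {Ω : Set E} (hΩ : IsOpen Ω)
    (hΩb : Bornology.IsBounded Ω) {u : E → ℝ} (hu : IntegrableOn u Ω) :
    MemBVH (fun i => G.field (X i : E)) Ω u ↔
      HasFiniteHPerimeter (fun i => G.prodReal.field (Y i : E × ℝ)) (Ω ×ˢ univ)
        (subgraphOn Ω u) := by
  have hχ : LocallyIntegrableOn ((subgraphOn Ω u).indicator fun _ => (1 : ℝ)) (Ω ×ˢ univ) :=
    locallyIntegrableOn_indicator_subgraphOn hΩ.measurableSet hu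
  rw [MemBVH, HasFiniteHPerimeter, and_iff_right hu, and_iff_right hχ,
    G.hasFiniteHVariation_iff_forall_mem_layer_one X hu.locallyIntegrableOn,
    G.prodReal.hasFiniteHVariation_iff_forall_mem_layer_one Y hχ, G.prodReal_layer_one]
  simp_rw [G.hasFiniteFieldVariation_prodReal_field_iff hΩ hΩb hu, Submodule.mem_prod]
  exact ⟨fun h w hw => h w.1 hw.1, fun h v hv => h (v, 0) ⟨hv, Submodule.mem_top⟩⟩

theorem theorem1p3 {n m : ℕ} (G : CarnotGroup (EuclideanSpace ℝ (Fin n)))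
    (X : Module.Basis (Fin m) ℝ (G.layer 1))
    (Y : Module.Basis (Fin (m + 1)) ℝ (G.prodReal.layer 1))
    (Ω : Set (EuclideanSpace ℝ (Fin n))) (hΩ : IsOpen Ω) (hΩb : Bornology.IsBounded Ω)
    (u : EuclideanSpace ℝ (Fin n) → ℝ) (hu : IntegrableOn u Ω) :
    MemBVH (fun i => G.field (X i : EuclideanSpace ℝ (Fin n))) Ω u ↔
      HasFiniteHPerimeter
        (fun i => G.prodReal.field (Y i : EuclideanSpace ℝ (Fin n) × ℝ))
        (Ω ×ˢ Set.univ) (subgraphOn Ω u) :=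
  theorem1p3_general G X Y hΩ hΩb hu
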